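/- Let $M$ be a smooth (Hausdorff, finite-dimensional) manifold without boundary, $A\to M$ a smooth real vector bundle of finite rank, and $\rho\colon A\to TM$ a smooth vector bundle morphism over $\mathrm{id}_M$ (the anchor) which is surjective on every fibre, so that $(A,\rho)$ is a transitive anchored bundle. Let $\nabla$ be a smooth $TM$-connection on $A$. For $X,Y\in\Gamma(A)$ put $$X\triangleright Y:=\nabla_{\rho(X)}Y,\qquad [\![X,Y]\!]:=X\triangleright Y-Y\triangleright X ,$$ so that $X\triangleright Y$ is the $A$-connection on $A$ induced by $\nabla$ and $[\![\cdot,\cdot]\!]$ is the commutator bracket; the same formulas define them on sections over open subsets of $M$. Call $(A,\rho,\nabla)$ a pre-Lie algebroid if $(\Gamma(A),\triangleright)$ is a pre-Lie algebra, i.e. if for all $X,Y,Z\in\Gamma(A)$ $$X\triangleright(Y\triangleright Z)-(X\triangleright Y)\triangleright Z=Y\triangleright(X\triangleright Z)-(Y\triangleright X)\triangleright Z .$$ An action of a finite-dimensional real Lie algebra $\mathfrak g$ on an open set $U\subseteq M$ is a Lie algebra homomorphism $\xi\mapsto\xi_M$ from $\mathfrak g$ to the smooth vector fields on $U$ with the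 Jacobi--Lie bracket; it is transitive if $\xi\mapsto\xi_M(x)$ maps $\mathfrak g$ onto $T_xM$ for every $x\in U$. Its action algebroid $\mathfrak g\ltimes U$ is the trivial bundle $\mathfrak g\times U\to U$ with anchor $(\xi,x)\mapsto\xi_M(x)$ and with the bracket $$[\![u,v]\!](x)=[u(x),v(x)]+dv_x\big(u(x)_M(x)\big)-du_x\big(v(x)_M(x)\big),\qquad u,v\in C^\infty(U,\mathfrak g);$$ its canonical flat connection is $\nabla_w u=du(w)$, which vanishes on constant sections. For an open set $U\subseteq M$, say that $(\ast_U)$ holds if there are a finite-dimensional abelian Lie algebra $\mathfrak g$, a transitive action of $\mathfrak g$ on $U$, and a smooth vector bundle isomorphism $\mathfrak g\ltimes U\to A|_U$ over $\mathrm{id}_U$ which preserves the anchors and the brackets (that of $A|_U$ being the commutator bracket $[\![\cdot,\cdot]\!]$) and carries the canonical flat connection to $\nabla$. **Theorem.** $(A,\rho,\nabla)$ is a pre-Lie algebroid if and only if every point of $M$ has an open neighbourhood $U$ for which $(\ast_U)$ holds. If $M$ is simply connected, then $(A,\rho,\nabla)$ is a pre-Lie algebroid if and only if $(\ast_M)$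 holds. -/

import Mathlib

open Bundle Set
open scoped Manifold ContDiff

set_option linter.unusedSectionVars false

noncomputable section

namespace PreLieAlgebroid

section Anchored

variable {E : Type*} [NormedAddCommGroup E] [NormedSpace ℝ E]
  {H : Type*} [TopologicalSpace H] (I : ModelWithCorners ℝ E H)
  {M : Type*} [TopologicalSpace M] [ChartedSpace H M] [IsManifold I ∞ M]
  (F : Type*) [NormedAddCommGroup F] [NormedSpace ℝ F]
  (A : M → Type*) [TopologicalSpace (TotalSpace F A)]
  [∀ x, AddCommGroup (A x)] [∀ x, Module ℝ (A x)] [∀ x, TopologicalSpace (A x)]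
  [∀ x, IsTopologicalAddGroup (A x)] [∀ x, ContinuousSMul ℝ (A x)]
  [FiberBundle F A] [VectorBundle ℝ F A]

/-- An anchor on the vector bundle `A → M`: a smooth vector bundle morphism `ρ : A → TM`
over the identity of `M`. Together, `A` and `ρ` form an anchored bundle. -/
structure Anchor where
  /-- the restriction of the anchor to each fibre -/
  toFun : ∀ x : M, A x →L[ℝ] TangentSpace I x
  smooth : ContMDiff (I.prod 𝓘(ℝ, F)) I.tangent ∞
    (fun v : TotalSpace F A => (⟨v.proj, toFun v.proj v.snd⟩ : TangentBundle I M))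

variable {I F A}

/-- The anchored bundle `(A, ρ)` is transitive: the anchor is surjective. -/
def Anchor.Transitive (ρ : Anchor I F A) : Prop :=
  ∀ x : M, Function.Surjective (ρ.toFun x)

/-- The anchor maps sections of `A` to vector fields on `M`. -/
def Anchor.onSection (ρ : Anchor I F A) (X : ∀ x : M, A x) : ∀ x : M, TangentSpace I x :=
  fun x => ρ.toFun x (X x)

/-- An `A`-connection on the bundle `A` itself: an `ℝ`-bilinear map
`(X, Y) ↦ ∇_X Y` on smooth sections, `C^∞(M)`-linear in `X` and satisfying
`∇_X (f Y) = ρ(X)[f] Y + f ∇_X Y`. The products `f X` and `f Y` are the sections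
`X'`, `Y'` with `X' x = f x • X x`, `Y' x = f x • Y x`. -/
structure AConnection (ρ : Anchor I F A) where
  /-- the bilinear map `(X, Y) ↦ ∇_X Y` -/
  toFun : Cₛ^∞⟮I; F, A⟯ →ₗ[ℝ] Cₛ^∞⟮I; F, A⟯ →ₗ[ℝ] Cₛ^∞⟮I; F, A⟯
  smul_left : ∀ (f : C^∞⟮I, M; ℝ⟯) (X X' Y : Cₛ^∞⟮I; F, A⟯),
    (∀ x, X' x = f x • X x) → ∀ x, toFun X' Y x = f x • toFun X Y x
  leibniz : ∀ (f : C^∞⟮I, M; ℝ⟯) (X Y Y' : Cₛ^∞⟮I; F, A⟯),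
    (∀ x, Y' x = f x • Y x) → ∀ x,
      toFun X Y' x = (mvfderiv I f x (ρ.onSection X x)) • Y x + f x • toFun X Y x

/-- The associator `a(X, Y, Z) = X ▷ (Y ▷ Z) - (X ▷ Y) ▷ Z` of the product `X ▷ Y = ∇_X Y`. -/
def AConnection.assoc {ρ : Anchor I F A} (D : AConnection ρ) (X Y Z : Cₛ^∞⟮I; F, A⟯) :
    Cₛ^∞⟮I; F, A⟯ :=
  D.toFun X (D.toFun Y Z) - D.toFun (D.toFun X Y) Z

/-- The associator triple bracket `[X, Y, Z] = a(X, Y, Z) - a(Y, X, Z)`. -/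
def AConnection.tripleBracket {ρ : Anchor I F A} (D : AConnection ρ)
    (X Y Z : Cₛ^∞⟮I; F, A⟯) : Cₛ^∞⟮I; F, A⟯ :=
  D.assoc X Y Z - D.assoc Y X Z

/-- `(A, ρ, ∇)` is a pre-Lie algebroid: the smooth sections of `A` with the product
`X ▷ Y = ∇_X Y` form a pre-Lie algebra. -/
def AConnection.IsPreLieAlgebroid {ρ : Anchor I F A} (D : AConnection ρ) : Prop :=
  ∀ X Y Z : Cₛ^∞⟮I; F, A⟯, D.tripleBracket X Y Z = 0

/-- The product `∇_{ρ(X)} Y` induced on (not necessarily globally smooth) sections of `A` by a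
`TM`-connection `∇` on `A`. Its value at `x` depends only on `X x` and on the germ of `Y`
at `x`, so it also makes sense for local sections. -/
def rawProd (ρ : Anchor I F A) (cov : CovariantDerivative I F A) (X Y : ∀ x : M, A x) :
    ∀ x : M, A x :=
  fun x => cov Y x (ρ.onSection X x)

/-- The commutator bracket `⟦X, Y⟧ = ∇_{ρ(X)} Y - ∇_{ρ(Y)} X`. -/
def commutatorBracket (ρ : Anchor I F A) (cov : CovariantDerivative I F A)
    (X Y : ∀ x : M, A x) : ∀ x : M, A x :=
  fun x => rawProd ρ cov X Y x - rawProd ρ cov Y X x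

theorem Anchor.contMDiff_onSection (ρ : Anchor I F A) (X : Cₛ^∞⟮I; F, A⟯) :
    ContMDiff I I.tangent ∞ (fun x => (⟨x, ρ.onSection X x⟩ : TangentBundle I M)) :=
  ρ.smooth.comp X.contMDiff

theorem contMDiff_rawProd (ρ : Anchor I F A) (cov : CovariantDerivative I F A)
    [h : CovariantDerivative.ContMDiffCovariantDerivative cov ∞] (X Y : Cₛ^∞⟮I; F, A⟯) :
    ContMDiff I (I.prod 𝓘(ℝ, F)) ∞ (fun x => TotalSpace.mk' F x (rawProd ρ cov X Y x)) := by
  have h1 := h.contMDiff.contMDiff (σ := fun x => Y x) (by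
    rw [contMDiffOn_univ]; exact Y.contMDiff)
  rw [contMDiffOn_univ] at h1
  exact ContMDiff.clm_bundle_apply h1 (ρ.contMDiff_onSection X)

/-- The `A`-connection `∇_X Y := ∇_{ρ(X)} Y` on `A` induced by a smooth `TM`-connection on
`A`. -/
def inducedConnection (ρ : Anchor I F A) (cov : CovariantDerivative I F A)
    [CovariantDerivative.ContMDiffCovariantDerivative cov ∞] : AConnection ρ where
  toFun := LinearMap.mk₂ ℝ (fun X Y => ⟨rawProd ρ cov X Y, contMDiff_rawProd ρ cov X Y⟩)
    (by intro X X' Y; ext x; simp [rawProd, Anchor.onSection])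
    (by intro c X Y; ext x; simp [rawProd, Anchor.onSection])
    (by
      intro X Y Y'; ext x
      have := cov.isCovariantDerivativeOnUniv.add
        (Y.mdifferentiableAt (x := x)) (Y'.mdifferentiableAt (x := x))
      change cov (⇑Y + ⇑Y') x _ = cov Y x _ + cov Y' x _
      rw [show cov (⇑Y + ⇑Y') x = _ from this]; rfl)
    (by
      intro c X Y; ext x
      have := cov.isCovariantDerivativeOnUniv.smul_const c (Y.mdifferentiableAt (x := x))
      change cov (c • ⇑Y) x _ = c • cov Y x _
      rw [show cov (c • ⇑Y) x = _ from this]; rfl)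
  smul_left := by
    intro f X X' Y h x
    simp [rawProd, Anchor.onSection, h x]
  leibniz := by
    intro f X Y Y' h x
    have h0 : (Y' : ∀ x, A x) = (f : M → ℝ) • (Y : ∀ x, A x) := funext h
    have := cov.isCovariantDerivativeOnUniv.leibniz (g := f)
      (Y.mdifferentiableAt (x := x)) (f.contMDiff.mdifferentiable (by simp) x)
    change cov Y' x _ = _ • Y x + f x • cov Y x _
    rw [h0, show cov ((f : M → ℝ) • (Y : ∀ x, A x)) x = _ from this]
    simp [add_comm]

end Anchored

/-- A Lie ring whose underlying additive group is normed; no relation between the norm and the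
bracket is required. -/
class NormedLieRing (g : Type*) extends NormedAddCommGroup g, LieRing g

/-- A real Lie algebra whose underlying vector space is normed. Every finite-dimensional real
Lie algebra can be given such a norm, and all norms give the same smooth `g`-valued
functions. -/
class NormedLieAlgebra (g : Type*) [NormedLieRing g] extends NormedSpace ℝ g, LieAlgebra ℝ g

section Action

variable {E : Type*} [NormedAddCommGroup E] [NormedSpace ℝ E]
  {H : Type*} [TopologicalSpace H] (I : ModelWithCorners ℝ E H)
  {M : Type*} [TopologicalSpace M] [ChartedSpace H M] [IsManifold I ∞ M]
  (g : Type*) [NormedLieRing g] [NormedLieAlgebra g]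

/-- An (infinitesimal) action of the Lie algebra `g` on the open submanifold `U` of `M`: a Lie
algebra homomorphism `ξ ↦ ξ_M` from `g` to the smooth vector fields on `U` with the Jacobi-Lie
bracket. Values outside `U` are irrelevant. -/
structure LieAlgebraAction (U : TopologicalSpace.Opens M) where
  /-- `toFun x ξ` is the value `ξ_M(x)` -/
  toFun : ∀ x : M, g →ₗ[ℝ] TangentSpace I x
  smooth : ∀ ξ : g, ContMDiffOn I I.tangent ∞
    (fun x => (⟨x, toFun x ξ⟩ : TangentBundle I M)) U
  map_lie : ∀ (ξ η : g), ∀ x ∈ U,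
    toFun x ⁅ξ, η⁆ = VectorField.mlieBracket I (fun y => toFun y ξ) (fun y => toFun y η) x

variable {I g} {U : TopologicalSpace.Opens M}

/-- The action of `g` on `U` is transitive: `ξ ↦ ξ_M(x)` is onto `T_x M` for all `x ∈ U`. -/
def LieAlgebraAction.Transitive (a : LieAlgebraAction I g U) : Prop :=
  ∀ x ∈ U, Function.Surjective (a.toFun x)

/-- The anchor `ρ(ξ, x) = ξ_M(x)` of the action algebroid `g ⋉ U`, applied to a section of the
trivial bundle `g × U`, that is, to a `g`-valued function `u`. -/
def LieAlgebraAction.anchor (a : LieAlgebraAction I g U) (u : M → g) :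
    ∀ x : M, TangentSpace I x :=
  fun x => a.toFun x (u x)

/-- The bracket of sections of the action algebroid `g ⋉ U`:
`⟦u, v⟧(x) = [u(x), v(x)] + dv_x(ρ(u)) - du_x(ρ(v))`. -/
def LieAlgebraAction.bracket (a : LieAlgebraAction I g U) (u v : M → g) : M → g :=
  fun x => ⁅u x, v x⁆ + mvfderiv I v x (a.anchor u x) - mvfderiv I u x (a.anchor v x)

/-- On constant sections, the bracket of the action algebroid is the bracket of `g`. -/
theorem LieAlgebraAction.bracket_const (a : LieAlgebraAction I g U) (ξ η : g) (x : M) :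
    a.bracket (fun _ => ξ) (fun _ => η) x = ⁅ξ, η⁆ := by
  simp [LieAlgebraAction.bracket, mvfderiv_const]

/-- The bracket of the action algebroid satisfies the Leibniz rule
`⟦u, f v⟧ = ρ(u)[f] v + f ⟦u, v⟧`. -/
theorem LieAlgebraAction.bracket_leibniz (a : LieAlgebraAction I g U) (f : M → ℝ) (u v : M → g)
    (x : M) (hf : MDifferentiableAt I 𝓘(ℝ, ℝ) f x) (hv : MDifferentiableAt I 𝓘(ℝ, g) v x) :
    a.bracket u (f • v) x = (mvfderiv I f x (a.anchor u x)) • v x + f x • a.bracket u v x := by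
  simp only [LieAlgebraAction.bracket, mvfderiv_smul hf hv, LieAlgebraAction.anchor,
    Pi.smul_apply', lie_smul, map_smul]
  simp [smul_sub, smul_add]
  abel

variable (I) in
/-- The canonical flat `TM`-connection on the trivial bundle with fibre `g`, the one which
vanishes on constant sections: `∇_w u = du(w)`. -/
def flatConnection (u : M → g) (x : M) (w : TangentSpace I x) : g :=
  mvfderiv I u x w

variable {F : Type*} [NormedAddCommGroup F] [NormedSpace ℝ F]
  {A : M → Type*} [TopologicalSpace (TotalSpace F A)]
  [∀ x, AddCommGroup (A x)] [∀ x, Module ℝ (A x)] [∀ x, TopologicalSpace (A x)]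
  [∀ x, IsTopologicalAddGroup (A x)] [∀ x, ContinuousSMul ℝ (A x)]
  [FiberBundle F A] [VectorBundle ℝ F A]

/-- An isomorphism, over the identity of the open set `U`, from the action algebroid `g ⋉ U` to
the restriction to `U` of the anchored bundle `(A, ρ)` with the commutator bracket of `∇`:
a smooth vector bundle morphism which is bijective on fibres and which preserves
the anchors and the brackets of all smooth sections over `U`. Values outside `U` are
irrelevant. -/
structure ActionAlgebroidIso (a : LieAlgebraAction I g U) (ρ : Anchor I F A)
    (cov : CovariantDerivative I F A) where
  /-- the map on each fibre -/
  toFun : ∀ x : M, g →ₗ[ℝ] A x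
  smooth : ContMDiffOn (I.prod 𝓘(ℝ, g)) (I.prod 𝓘(ℝ, F)) ∞
    (fun p : M × g => TotalSpace.mk' F p.1 (toFun p.1 p.2)) ((U : Set M) ×ˢ univ)
  bijective : ∀ x ∈ U, Function.Bijective (toFun x)
  map_anchor : ∀ x ∈ U, ∀ ξ : g, ρ.toFun x (toFun x ξ) = a.toFun x ξ
  map_bracket : ∀ u v : M → g, ContMDiffOn I 𝓘(ℝ, g) ∞ u U → ContMDiffOn I 𝓘(ℝ, g) ∞ v U →
    ∀ x ∈ U, toFun x (a.bracket u v x) =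
      commutatorBracket ρ cov (fun y => toFun y (u y)) (fun y => toFun y (v y)) x

/-- The isomorphism carries the canonical flat connection of `g ⋉ U` to `∇`. -/
def ActionAlgebroidIso.PreservesConnection {a : LieAlgebraAction I g U} {ρ : Anchor I F A}
    {cov : CovariantDerivative I F A} (Φ : ActionAlgebroidIso a ρ cov) : Prop :=
  ∀ u : M → g, ContMDiffOn I 𝓘(ℝ, g) ∞ u U → ∀ x ∈ U, ∀ w : TangentSpace I x,
    cov (fun y => Φ.toFun y (u y)) x w = Φ.toFun x (flatConnection I u x w)

/-- Over `U`, the bundle `(A, ρ)` with the commutator bracket of `∇` is isomorphic to the action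
algebroid of a transitive action on `U` of some finite-dimensional abelian Lie algebra, and `∇`
corresponds to the canonical flat connection. -/
def IsAbelianActionAlgebroidOn (ρ : Anchor I F A) (cov : CovariantDerivative I F A)
    (U : TopologicalSpace.Opens M) : Prop :=
  ∃ (g : Type) (_ : NormedLieRing g) (_ : NormedLieAlgebra g),
    FiniteDimensional ℝ g ∧ IsLieAbelian g ∧
    ∃ a : LieAlgebraAction I g U, a.Transitive ∧
    ∃ Φ : ActionAlgebroidIso a ρ cov, Φ.PreservesConnection

end Action

end PreLieAlgebroid

end

/-! In a frame and a chart, ∇ = d + θ, and the associator triple bracket of X, Y, Z is ∇_T Z + R(ρX,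
ρY)Z. Here R is the curvature and T = [ρX, ρY] - ρ⟦X, Y⟧ measures the failure of the anchor to
preserve brackets (`localTriple_eq`). Both T and R are tensorial. If the bracket vanishes
identically, testing on a Z that vanishes at a point with prescribed derivative there gives T = 0.
Then R = 0, because ρ is onto. So the pre-Lie identity says exactly that ∇ is flat and ρ preserves
brackets.

Flatness yields parallel frames near every point (`exists_isUnit_parallel`, `exists_parallelFrame`).
Constant sections of a parallel frame have zero commutator bracket, so T = 0 says that their anchors
are commuting vector fields: an action of an abelian Lie algebra, whose action algebroid is A with ∇
as its flat connection (`isAbelianActionAlgebroidOn_of_parallelFrame`). Conversely, an isomorphism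
with an abelian action algebroid is a parallel frame with commuting anchors, so θ = 0 and T = 0, and
the formula makes the triple bracket vanish (`IsAbelianActionAlgebroidOn.tripleBracket_apply`).

For the global statement, parallel frames differ by locally constant maps, so they assemble into a
covering space of M. Over a simply connected M this covering has a section, which is a global
parallel frame (`exists_global_parallelFrame`). -/

noncomputable section

namespace PreLieAlgebroid

/-! ### Flat connection forms on open sets of a vector space: solving dP = -θP. -/

section ParallelTransport

open Metric Filter Topology

variable {E : Type*} [NormedAddCommGroup E] [NormedSpace ℝ E]
  {B : Type*} [NormedRing B] [NormedAlgebra ℝ B]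

/-- The curvature `dθ(h, k) + [θ(h), θ(k)]` of a connection form with values in an algebra. -/
def curvatureForm (θ : E → E →L[ℝ] B) (y h k : E) : B :=
  fderiv ℝ θ y h k - fderiv ℝ θ y k h + θ y h * θ y k - θ y k * θ y h

/-- The right-hand side of the equation `dP = -θ P` for parallel frames. -/
def parallelDeriv (θ : E → E →L[ℝ] B) (y : E) (P : B) : E →L[ℝ] B :=
  -((ContinuousLinearMap.mul ℝ B).flip P ∘L θ y)

@[simp]
theorem parallelDeriv_apply (θ : E → E →L[ℝ] B) (y : E) (P : B) (h : E) :
    parallelDeriv θ y P h = -(θ y h * P) := by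
  simp [parallelDeriv]

/-- Parallel transport along radial segments, of a connection form small enough on a ball. -/
theorem exists_radial_solution [CompleteSpace B] {θ : E → E →L[ℝ] B} {x : E} {C : ℝ}
    (hθ : ContinuousOn (fun t : ℝ => θ (t • x)) (Icc 0 1))
    (hC : ∀ t ∈ Icc (0 : ℝ) 1, ‖θ (t • x)‖ ≤ C) (hx : C * ‖x‖ * (1 + ‖(1 : B)‖) ≤ 1) :
    ∃ p : ℝ → B, p 0 = 1 ∧ ∀ t ∈ Icc (0 : ℝ) 1,
      HasDerivWithinAt p (-(θ (t • x) x * p t)) (Icc 0 1) t := by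
  have hC0 : 0 ≤ C := (norm_nonneg _).trans (hC 0 (by simp))
  have hb : ∀ t ∈ Icc (0 : ℝ) 1, ‖θ (t • x) x‖ ≤ C * ‖x‖ := fun t ht =>
    ((θ (t • x)).le_opNorm x).trans (by gcongr; exact hC t ht)
  have hK : C * ‖x‖ ≤ 1 := by
    have : 0 ≤ C * ‖x‖ * ‖(1 : B)‖ := by positivity
    linarith
  -- On the closed unit ball around 1 one has ‖P‖ ≤ 1 + ‖1‖, so `hx` bounds the speed by 1 and the
  -- solution stays in that ball for the whole unit time.
  have : IsPicardLindelof (fun t P => -(θ (t • x) x * P))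
      (⟨0, by simp⟩ : Icc (0 : ℝ) 1) (1 : B) 1 0 1 1 :=
    { lipschitzOnWith := fun t ht => LipschitzOnWith.of_dist_le_mul fun P _ Q _ => by
        rw [dist_neg_neg, dist_eq_norm, dist_eq_norm, ← mul_sub]
        refine (norm_mul_le _ _).trans ?_
        gcongr
        exact (hb t ht).trans hK
      continuousOn := fun P _ =>
        ((hθ.clm_apply continuousOn_const).mul continuousOn_const).neg
      norm_le := fun t ht P hP => by
        rw [norm_neg]
        refine (norm_mul_le _ _).trans ?_
        have hP' : ‖P‖ ≤ 1 + ‖(1 : B)‖ := by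
          have h1 : ‖P - 1‖ ≤ 1 := by simpa [dist_eq_norm] using hP
          have h2 := norm_add_le (P - 1) 1
          rw [sub_add_cancel] at h2
          linarith
        refine (mul_le_mul (hb t ht) hP' (norm_nonneg _) (by positivity)).trans (by simpa using hx)
      mul_max_le := by simp }
  exact this.exists_eq_forall_mem_Icc_hasDerivWithinAt₀

/-- For a flat connection form, radial parallel transport is parallel in all directions. -/
theorem hasFDerivAt_radial_solution {θ : E → E →L[ℝ] B} {ρ C L K : ℝ} (hρ : ρ ≤ 1)
    (hC1 : 0 < C) (hL0 : 0 ≤ L) (hK0 : 0 ≤ K)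
    (hd : ∀ y ∈ ball (0 : E) ρ, DifferentiableAt ℝ θ y)
    (hC : ∀ y ∈ ball (0 : E) ρ, ‖θ y‖ ≤ C)
    (hL : ∀ y ∈ ball (0 : E) ρ, ∀ z ∈ ball (0 : E) ρ, ‖θ z - θ y‖ ≤ L * ‖z - y‖)
    (hK : ∀ y ∈ ball (0 : E) ρ, ∀ z ∈ ball (0 : E) ρ,
      ‖θ z - θ y - fderiv ℝ θ y (z - y)‖ ≤ K * ‖z - y‖ ^ 2)
    (hflat : ∀ y ∈ ball (0 : E) ρ, ∀ h k, curvatureForm θ y h k = 0)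
    {p : E → ℝ → B} (hp0 : ∀ x ∈ ball (0 : E) ρ, p x 0 = 1)
    (hp : ∀ x ∈ ball (0 : E) ρ, ∀ t ∈ Icc (0 : ℝ) 1,
      HasDerivWithinAt (p x) (-(θ (t • x) x * p x t)) (Icc 0 1) t)
    {x : E} (hx : x ∈ ball (0 : E) ρ) :
    HasFDerivAt (fun y => p y 1) (parallelDeriv θ x (p x 1)) x := by
  have hball : ∀ y ∈ ball (0 : E) ρ, ∀ t ∈ Icc (0 : ℝ) 1, t • y ∈ ball (0 : E) ρ := by
    intro y hy t ht
    rw [mem_ball_zero_iff] at hy ⊢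
    rw [norm_smul, Real.norm_of_nonneg ht.1]
    exact (mul_le_of_le_one_left (norm_nonneg _) ht.2).trans_lt hy
  obtain ⟨S, hS⟩ : ∃ S, ∀ t ∈ Icc (0 : ℝ) 1, ‖p x t‖ ≤ S :=
    isCompact_Icc.exists_bound_of_continuousOn fun t ht => (hp x hx t ht).continuousWithinAt
  have hS0 : 0 ≤ S := (norm_nonneg _).trans (hS 0 (by simp))
  set c := (K + L + (L + C) * C) * S with hc
  have key : ∀ h : E, x + h ∈ ball (0 : E) ρ →
      ‖p (x + h) 1 - p x 1 + θ x h * p x 1‖ ≤ c / C * (Real.exp C - 1) * ‖h‖ ^ 2 := by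
    intro h hxh
    -- The point t • x moves by t • h, so the expected first-order change of `p x t` is -t θ(t •
    -- x)(h) `p x t`. Gronwall shows that the error is quadratic in h; it starts at 0, hence δ = 0.
    have hgr := norm_le_gronwallBound_of_norm_deriv_right_le (E := B) (δ := 0) (K := C)
      (ε := c * ‖h‖ ^ 2) (a := 0) (b := 1)
      (f := fun t => p (x + h) t - p x t + t • (θ (t • x) h * p x t))
      (f' := fun t => -(θ (t • (x + h)) (x + h) * p (x + h) t) - -(θ (t • x) x * p x t) +
        (t • (fderiv ℝ θ (t • x) x h * p x t + θ (t • x) h * -(θ (t • x) x * p x t)) +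
          (1 : ℝ) • (θ (t • x) h * p x t)))
    have hder : ∀ t ∈ Icc (0 : ℝ) 1, HasDerivWithinAt
        (fun t => p (x + h) t - p x t + t • (θ (t • x) h * p x t))
        (-(θ (t • (x + h)) (x + h) * p (x + h) t) - -(θ (t • x) x * p x t) +
        (t • (fderiv ℝ θ (t • x) x h * p x t + θ (t • x) h * -(θ (t • x) x * p x t)) +
          (1 : ℝ) • (θ (t • x) h * p x t))) (Icc 0 1) t := by
      intro t ht
      have h1 : HasDerivAt (fun t : ℝ => θ (t • x)) (fderiv ℝ θ (t • x) x) t := by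
        have := (hd _ (hball x hx t ht)).hasFDerivAt.comp_hasDerivAt t
          ((hasDerivAt_id t).smul_const x)
        simpa using! this
      have h2 : HasDerivAt (fun t : ℝ => θ (t • x) h) (fderiv ℝ θ (t • x) x h) t := by
        simpa using! h1.clm_apply (hasDerivAt_const t h)
      exact ((hp _ hxh t ht).sub (hp x hx t ht)).add
        ((hasDerivAt_id t).hasDerivWithinAt.smul (h2.hasDerivWithinAt.mul (hp x hx t ht)))
    have := hgr (fun t ht => (hder t ht).continuousWithinAt)
      (fun t ht => (hder t (Ico_subset_Icc_self ht)).mono_of_mem_nhdsWithin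
        (Icc_mem_nhdsGE_of_mem ht)) (by simp [hp0 x hx, hp0 _ hxh]) ?_ 1 (by simp)
    · rw [gronwallBound_of_K_ne_0 hC1.ne'] at this
      simp only [one_smul] at this
      refine this.trans (le_of_eq ?_)
      simp
      ring
    · intro t ht
      have ht' := Ico_subset_Icc_self ht
      have hy := hball x hx t ht'
      have hz := hball _ hxh t ht'
      set y := t • x with hyd
      set z := t • (x + h) with hzd
      have hzy : z - y = t • h := by rw [hyd, hzd, smul_add]; abel
      set P := p x t
      set Q := p (x + h) t
      have hnt : ‖z - y‖ ≤ ‖h‖ := by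
        rw [hzy, norm_smul, Real.norm_of_nonneg ht'.1]
        exact mul_le_of_le_one_left (norm_nonneg _) ht'.2
      have hfl := hflat y hy x h
      -- The derivative of the error is -θ(z)(x + h) times the error, plus terms of second order in
      -- h; these account for the three summands of `c`.
      have hid : -(θ z (x + h) * Q) - -(θ y x * P) +
          (t • (fderiv ℝ θ y x h * P + θ y h * -(θ y x * P)) + (1 : ℝ) • (θ y h * P)) =
          -(θ z (x + h) * (Q - P + t • (θ y h * P))) +
          (-((θ z - θ y - fderiv ℝ θ y (z - y)) x * P) - (θ z - θ y) h * P +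
            t • (((θ z - θ y) x + θ z h) * (θ y h * P))) := by
        -- Flatness enters only here: it trades the derivative of θ along the ray for the derivative
        -- along h, which then cancels the first-order part of θ z - θ y.
        have e : fderiv ℝ θ y x h = fderiv ℝ θ y h x - θ y x * θ y h + θ y h * θ y x := by
          rw [curvatureForm] at hfl
          have := sub_eq_zero.mp hfl
          rw [← this]; abel
        rw [e, hzy]
        simp only [map_add, map_smul, sub_apply,
          smul_apply, add_mul, sub_mul, mul_add, mul_sub, smul_add,
          smul_sub, mul_neg, one_smul, mul_smul_comm, smul_mul_assoc, mul_assoc, smul_neg]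
        abel
      rw [hid]
      have hPS : ‖P‖ ≤ S := hS t ht'
      have hx1 : ‖x‖ ≤ 1 := ((mem_ball_zero_iff.mp hx).le).trans hρ
      have hxh1 : ‖x + h‖ ≤ 1 := ((mem_ball_zero_iff.mp hxh).le).trans hρ
      have b0 : ‖θ z (x + h)‖ ≤ C := ((θ z).le_opNorm _).trans
        (by simpa using mul_le_mul (hC z hz) hxh1 (norm_nonneg _) hC1.le)
      have b1 : ‖(θ z - θ y - fderiv ℝ θ y (z - y)) x‖ ≤ K * ‖h‖ ^ 2 := by
        refine (ContinuousLinearMap.le_opNorm _ _).trans ?_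
        have := (hK y hy z hz).trans
          (mul_le_mul_of_nonneg_left (pow_le_pow_left₀ (norm_nonneg _) hnt 2) hK0)
        simpa using mul_le_mul this hx1 (norm_nonneg _) (by positivity)
      have b2' : ‖θ z - θ y‖ ≤ L * ‖h‖ := (hL y hy z hz).trans (by gcongr)
      have b2 : ‖(θ z - θ y) h‖ ≤ L * ‖h‖ * ‖h‖ :=
        (ContinuousLinearMap.le_opNorm _ _).trans (by gcongr)
      have b3 : ‖(θ z - θ y) x‖ ≤ L * ‖h‖ := by
        refine (ContinuousLinearMap.le_opNorm _ _).trans ?_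
        simpa using mul_le_mul b2' hx1 (norm_nonneg _) (by positivity)
      have b4 : ‖θ z h‖ ≤ C * ‖h‖ := ((θ z).le_opNorm _).trans (by gcongr; exact hC z hz)
      have b5 : ‖θ y h‖ ≤ C * ‖h‖ := ((θ y).le_opNorm _).trans (by gcongr; exact hC y hy)
      refine (norm_add_le _ _).trans (add_le_add ?_ ?_)
      · rw [norm_neg]
        exact (norm_mul_le _ _).trans (by gcongr)
      · have c1 : ‖(θ z - θ y - fderiv ℝ θ y (z - y)) x * P‖ ≤ K * ‖h‖ ^ 2 * S :=
          (norm_mul_le _ _).trans (by gcongr)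
        have c2 : ‖(θ z - θ y) h * P‖ ≤ L * ‖h‖ * ‖h‖ * S :=
          (norm_mul_le _ _).trans (by gcongr)
        have c3 : ‖t • (((θ z - θ y) x + θ z h) * (θ y h * P))‖ ≤
            (L * ‖h‖ + C * ‖h‖) * (C * ‖h‖ * S) := by
          rw [norm_smul, Real.norm_of_nonneg ht'.1]
          refine (mul_le_of_le_one_left (norm_nonneg _) ht'.2).trans ?_
          refine (norm_mul_le _ _).trans ?_
          gcongr
          · exact (norm_add_le _ _).trans (add_le_add b3 b4)
          · exact (norm_mul_le _ _).trans (by gcongr)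
        refine (norm_add_le _ _).trans ((add_le_add_left (norm_sub_le _ _) _).trans ?_)
        rw [norm_neg]
        refine (add_le_add (add_le_add c1 c2) c3).trans (le_of_eq ?_)
        rw [hc]; ring
  refine .of_isLittleO ?_
  rw [← map_add_left_nhds_zero x, Asymptotics.isLittleO_map]
  have hO : (fun h => p (x + h) 1 - p x 1 - parallelDeriv θ x (p x 1) (x + h - x)) =O[𝓝 0]
      fun h : E => ‖h‖ ^ 2 := by
    refine Asymptotics.IsBigO.of_bound (c / C * (Real.exp C - 1)) ?_
    have : ∀ᶠ h in 𝓝 (0 : E), x + h ∈ ball (0 : E) ρ := by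
      have : Tendsto (fun h => x + h) (𝓝 (0 : E)) (𝓝 x) := by
        simpa using (continuous_const.add continuous_id).tendsto (f := fun h => x + h) (0 : E)
      exact this (isOpen_ball.mem_nhds hx)
    filter_upwards [this] with h hh
    simpa using key h hh
  refine (hO.trans_isLittleO ?_).congr_left (fun _ => rfl)
  have := Asymptotics.isLittleO_norm_pow_id (E' := E) (n := 2) (by norm_num)
  exact this |>.congr_right (fun h => (add_sub_cancel_left x h).symm)

/-- A primitive of a flat connection form is as smooth as the form. -/
theorem contDiffOn_of_hasFDerivAt_parallelDeriv {θ : E → E →L[ℝ] B} {V : Set E} (hV : IsOpen V)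
    (hθ : ContDiffOn ℝ ∞ θ V) {P : E → B}
    (hP : ∀ y ∈ V, HasFDerivAt P (parallelDeriv θ y (P y)) y) : ContDiffOn ℝ ∞ P V := by
  rw [contDiffOn_infty]
  intro n
  -- Bootstrapping: once P is C^n, so is dP = -θP, hence P is C^(n+1).
  induction n with
  | zero => exact contDiffOn_zero.mpr fun y hy => (hP y hy).continuousAt.continuousWithinAt
  | succ n ih =>
    push_cast
    rw [contDiffOn_succ_iff_fderiv_of_isOpen hV]
    refine ⟨fun y hy => (hP y hy).differentiableAt.differentiableWithinAt, by simp, ?_⟩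
    have : ContDiffOn ℝ n (fun y => parallelDeriv θ y (P y)) V := by
      unfold parallelDeriv
      exact (ContDiffOn.clm_comp
        ((ContinuousLinearMap.mul ℝ B).flip.contDiff.comp_contDiffOn ih)
        (hθ.of_le (by exact_mod_cast le_top))).neg
    exact this.congr fun y hy => (hP y hy).fderiv

/-- P(x) is the time-1 value of parallel transport along the ray from 0 to x. Local Lipschitz
constants of θ and of its derivative supply the bounds that make P parallel in all directions. -/
theorem exists_parallel_near_zero [CompleteSpace B] {θ : E → E →L[ℝ] B} {U : Set E}
    (hU : IsOpen U) (h0 : (0 : E) ∈ U) (hθ : ContDiffOn ℝ ∞ θ U)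
    (hflat : ∀ y ∈ U, ∀ h k, curvatureForm θ y h k = 0) :
    ∃ ρ > 0, ball (0 : E) ρ ⊆ U ∧ ∃ P : E → B, P 0 = 1 ∧
      ∀ y ∈ ball (0 : E) ρ, HasFDerivAt P (parallelDeriv θ y (P y)) y := by
  have hθ0 : ContDiffAt ℝ ∞ θ 0 := hθ.contDiffAt (hU.mem_nhds h0)
  obtain ⟨L, s, hs, hL⟩ := (hθ0.of_le (m := 1) (by simp)).exists_lipschitzOnWith
  obtain ⟨K, s', hs', hK⟩ := (hθ0.fderiv_right (m := 1)
    (by rw [one_add_one_eq_two]; exact ENat.LEInfty.out)).exists_lipschitzOnWith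
  have hcont : ∀ᶠ y in 𝓝 (0 : E), ‖θ y‖ < ‖θ 0‖ + 1 :=
    hθ0.continuousAt.norm.eventually (gt_mem_nhds (by linarith))
  obtain ⟨r, hr, hrs⟩ := Metric.eventually_nhds_iff_ball.mp
    ((((eventually_mem_set.mpr hs).and (eventually_mem_set.mpr hs')).and hcont).and
      (eventually_mem_set.mpr (hU.mem_nhds h0)))
  set C := ‖θ 0‖ + 1 with hCdef
  have hC0 : 0 < C := by positivity
  -- The last bound is the smallness condition of `exists_radial_solution`; the bound by 1 is
  -- required by `hasFDerivAt_radial_solution`.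
  set ρ := min (min r 1) (1 / (C * (1 + ‖(1 : B)‖))) with hρ
  have hρ0 : 0 < ρ := by positivity
  have hρr : ball (0 : E) ρ ⊆ ball 0 r :=
    ball_subset_ball ((min_le_left _ _).trans (min_le_left _ _))
  have hball : ∀ y ∈ ball (0 : E) ρ, ∀ t ∈ Icc (0 : ℝ) 1, t • y ∈ ball (0 : E) ρ := by
    intro y hy t ht
    rw [mem_ball_zero_iff] at hy ⊢
    rw [norm_smul, Real.norm_of_nonneg ht.1]
    exact (mul_le_of_le_one_left (norm_nonneg _) ht.2).trans_lt hy
  have hd : ∀ y ∈ ball (0 : E) ρ, DifferentiableAt ℝ θ y := fun y hy =>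
    (hθ.contDiffAt (hU.mem_nhds (hrs y (hρr hy)).2)).differentiableAt (by simp)
  have hsol : ∀ x, ∃ p : ℝ → B, p 0 = 1 ∧ (x ∈ ball (0 : E) ρ → ∀ t ∈ Icc (0 : ℝ) 1,
      HasDerivWithinAt p (-(θ (t • x) x * p t)) (Icc 0 1) t) := by
    intro x
    by_cases hx : x ∈ ball (0 : E) ρ
    · obtain ⟨p, hp0, hp⟩ := exists_radial_solution (θ := θ) (x := x) (C := C)
        (fun t ht => ((hd _ (hball x hx t ht)).continuousAt.comp
          (f := fun t : ℝ => t • x) (by fun_prop)).continuousWithinAt)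
        (fun t ht => ((hrs _ (hρr (hball x hx t ht))).1.2).le) (by
          have h1 : ‖x‖ ≤ 1 / (C * (1 + ‖(1 : B)‖)) :=
            (mem_ball_zero_iff.mp hx).le.trans (min_le_right _ _)
          rw [le_div_iff₀ (by positivity)] at h1
          linarith)
      exact ⟨p, hp0, fun _ => hp⟩
    · exact ⟨fun _ => 1, rfl, fun h => absurd h hx⟩
  choose p hp0 hp using hsol
  refine ⟨ρ, hρ0, fun y hy => (hrs y (hρr hy)).2, fun x => p x 1, ?_, fun y hy => ?_⟩
  · have h00 : (0 : E) ∈ ball (0 : E) ρ := mem_ball_self hρ0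
    -- Along the degenerate ray at 0 the equation reads p' = 0, so p stays equal to 1.
    have := (convex_Icc (0 : ℝ) 1).is_const_of_fderivWithin_eq_zero (𝕜 := ℝ) (f := p 0)
      (fun t ht => (hp 0 h00 t ht).differentiableWithinAt) (fun t ht => by
        have h := hp 0 h00 t ht
        rw [map_zero, zero_mul, neg_zero] at h
        ext
        rw [h.hasFDerivWithinAt.fderivWithin (uniqueDiffOn_Icc one_pos t ht)]
        simp) (x := 1) (y := 0) (by simp) (by simp)
    exact this.trans (hp0 0)
  · refine hasFDerivAt_radial_solution (ρ := ρ) (C := C) (L := L) (K := K)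
      ((min_le_left _ _).trans (min_le_right _ _)) hC0 L.2 K.2 hd
      (fun y hy => ((hrs y (hρr hy)).1.2).le)
      (fun y hy z hz => hL.norm_sub_le (hrs z (hρr hz)).1.1.1 (hrs y (hρr hy)).1.1.1)
      (fun y hy z hz => ?_) (fun y hy => hflat y (hrs y (hρr hy)).2) (fun x _ => hp0 x) hp hy
    -- Second-order Taylor bound: on this convex set, which contains y and z, the derivative of θ
    -- stays within K‖z - y‖ of its value at y.
    have hconv : Convex ℝ (ball (0 : E) ρ ∩ closedBall y ‖z - y‖) :=
      (convex_ball _ _).inter (convex_closedBall _ _)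
    have := hconv.norm_image_sub_le_of_norm_hasFDerivWithin_le' (f := θ)
      (f' := fun w => fderiv ℝ θ w) (φ := fderiv ℝ θ y) (C := K * ‖z - y‖)
      (fun w hw => (hd w hw.1).hasFDerivAt.hasFDerivWithinAt)
      (fun w hw => (hK.norm_sub_le (hrs w (hρr hw.1)).1.1.2 (hrs y (hρr hy)).1.1.2).trans (by
        have := hw.2
        rw [mem_closedBall, dist_eq_norm] at this
        gcongr)) ⟨hy, by simp⟩ ⟨hz, by simp [dist_eq_norm]⟩
    rwa [mul_assoc, ← sq] at this

/-- A flat connection form has an invertible parallel frame near every point. -/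
theorem exists_isUnit_parallel [CompleteSpace B] {θ : E → E →L[ℝ] B} {U : Set E}
    (hU : IsOpen U) {y₀ : E} (hy₀ : y₀ ∈ U) (hθ : ContDiffOn ℝ ∞ θ U)
    (hflat : ∀ y ∈ U, ∀ h k, curvatureForm θ y h k = 0) :
    ∃ V ⊆ U, IsOpen V ∧ y₀ ∈ V ∧ ∃ P : E → B, ContDiffOn ℝ ∞ P V ∧ (∀ y ∈ V, IsUnit (P y)) ∧
      ∀ y ∈ V, HasFDerivAt P (parallelDeriv θ y (P y)) y := by
  have hsh : Continuous fun x : E => y₀ + x := by fun_prop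
  obtain ⟨ρ, hρ, hρU, P, hP0, hP⟩ := exists_parallel_near_zero (θ := fun x => θ (y₀ + x))
    (U := (fun x => y₀ + x) ⁻¹' U) (hU.preimage hsh) (by simpa)
    (hθ.comp (by fun_prop) (fun x hx => hx)) (fun y hy h k => by
      have := hflat _ hy h k
      rw [curvatureForm] at this ⊢
      simpa only [fderiv_comp_add_left] using this)
  have hQ : ∀ y ∈ ball y₀ ρ, HasFDerivAt (fun y => P (y - y₀)) (parallelDeriv θ y (P (y - y₀))) y := by
    intro y hy
    have := hP (y - y₀) (by simpa [dist_eq_norm] using hy)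
    have h2 := (hasFDerivAt_comp_sub (x := y) y₀).mpr this
    have e : parallelDeriv (fun x => θ (y₀ + x)) (y - y₀) (P (y - y₀)) =
      parallelDeriv θ y (P (y - y₀)) := by simp [parallelDeriv]
    rwa [e] at h2
  have hcd := contDiffOn_of_hasFDerivAt_parallelDeriv (isOpen_ball (x := y₀) (ε := ρ))
    (hθ.mono fun y hy => by
      have : y - y₀ ∈ ball (0 : E) ρ := by simpa [dist_eq_norm] using hy
      simpa using hρU this) hQ
  -- Units form an open set in a complete normed algebra and P = 1 at y₀, so shrinking the ball
  -- makes P invertible.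
  refine ⟨ball y₀ ρ ∩ (fun y => P (y - y₀)) ⁻¹' {b | IsUnit b}, fun y hy => ?_,
    hcd.continuousOn.isOpen_inter_preimage isOpen_ball Units.isOpen, ⟨mem_ball_self hρ, ?_⟩,
    fun y => P (y - y₀), hcd.mono inter_subset_left, fun y hy => hy.2, fun y hy => hQ y hy.1⟩
  · have : y - y₀ ∈ ball (0 : E) ρ := by simpa [dist_eq_norm] using hy.1
    simpa using hρU this
  · simp [hP0]

end ParallelTransport

/-! ### The triple bracket in coordinates, and what its vanishing implies. -/

section LocalProduct

open Filter Topology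

variable {E : Type*} [NormedAddCommGroup E] [NormedSpace ℝ E]
  {g : Type*} [NormedAddCommGroup g] [NormedSpace ℝ g]

/-- The product `∇_{ρ(u)} v` for the trivial bundle with fibre `g` over `E`, with anchor `r` and
connection `d + θ`. -/
def localProd (r : E → g →L[ℝ] E) (θ : E → E →L[ℝ] g →L[ℝ] g) (u v : E → g) : E → g :=
  fun y => fderiv ℝ v y (r y (u y)) + θ y (r y (u y)) (v y)

/-- The associator triple bracket of `localProd`. -/
def localTriple (r : E → g →L[ℝ] E) (θ : E → E →L[ℝ] g →L[ℝ] g) (u v w : E → g) : E → g :=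
  fun y => localProd r θ u (localProd r θ v w) y - localProd r θ (localProd r θ u v) w y -
    (localProd r θ v (localProd r θ u w) y - localProd r θ (localProd r θ v u) w y)

/-- The failure `[ρ(a), ρ(b)] - ρ(⟦a, b⟧)` of the anchor to preserve brackets, for constant
sections `a` and `b`. -/
def anchorDefect (r : E → g →L[ℝ] E) (θ : E → E →L[ℝ] g →L[ℝ] g) (y : E) (a b : g) : E :=
  fderiv ℝ r y (r y a) b - fderiv ℝ r y (r y b) a - r y (θ y (r y a) b) + r y (θ y (r y b) a)

variable {r : E → g →L[ℝ] E} {θ : E → E →L[ℝ] g →L[ℝ] g} {u v w : E → g} {y : E}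

theorem localProd_apply :
    localProd r θ u v y = fderiv ℝ v y (r y (u y)) + θ y (r y (u y)) (v y) :=
  rfl

theorem fderiv_localProd_apply (hr : DifferentiableAt ℝ r y) (hθ : DifferentiableAt ℝ θ y)
    (hv : DifferentiableAt ℝ v y) (hw : DifferentiableAt ℝ w y)
    (hw' : DifferentiableAt ℝ (fderiv ℝ w) y) (h : E) :
    fderiv ℝ (localProd r θ v w) y h =
      fderiv ℝ (fderiv ℝ w) y h (r y (v y)) +
        fderiv ℝ w y (fderiv ℝ r y h (v y) + r y (fderiv ℝ v y h)) +
        (fderiv ℝ θ y h (r y (v y)) (w y) +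
          θ y (fderiv ℝ r y h (v y) + r y (fderiv ℝ v y h)) (w y) +
          θ y (r y (v y)) (fderiv ℝ w y h)) := by
  have h1 := hr.hasFDerivAt.clm_apply hv.hasFDerivAt
  have h2 := hw'.hasFDerivAt.clm_apply h1
  have h3 := (hθ.hasFDerivAt.clm_apply h1).clm_apply hw.hasFDerivAt
  have h4 := (h2.add h3).fderiv
  rw [show localProd r θ v w = (fun y => fderiv ℝ w y (r y (v y))) +
    fun y => θ y (r y (v y)) (w y) from rfl, h4]
  simp
  abel

/-- The second derivatives of w cancel by symmetry, and the derivatives of u and v cancel between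
the two associators. What remains is ∇_T w + R(ρu, ρv)w, which depends only on the values of u and v
and the first jet of w at y. -/
theorem localTriple_eq (hr : DifferentiableAt ℝ r y) (hθ : DifferentiableAt ℝ θ y)
    (hu : DifferentiableAt ℝ u y) (hv : DifferentiableAt ℝ v y) (hw : ContDiffAt ℝ 2 w y) :
    localTriple r θ u v w y =
      fderiv ℝ w y (anchorDefect r θ y (u y) (v y)) +
        θ y (anchorDefect r θ y (u y) (v y)) (w y) +
        curvatureForm θ y (r y (u y)) (r y (v y)) (w y) := by
  have hw1 : DifferentiableAt ℝ w y := hw.differentiableAt (by simp)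
  have hw2 : DifferentiableAt ℝ (fderiv ℝ w) y :=
    (hw.fderiv_right (m := 1) (by rw [one_add_one_eq_two])).differentiableAt (by simp)
  have hsymm := (hw.isSymmSndFDerivAt (by simp)).eq (r y (u y)) (r y (v y))
  have e1 := fderiv_localProd_apply hr hθ hv hw1 hw2 (r y (u y))
  have e2 := fderiv_localProd_apply hr hθ hu hw1 hw2 (r y (v y))
  simp only [localTriple]
  rw [localProd_apply (v := localProd r θ v w), localProd_apply (v := localProd r θ u w), e1, e2,
    hsymm]
  simp only [localProd, anchorDefect, curvatureForm, map_add, map_sub, add_apply, sub_apply,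
    mul_apply_eq_comp]
  abel

/-- If T ≠ 0, choose a functional l with l(T) ≠ 0 and test on w = l(· - y) c. Since w vanishes at y,
only the derivative term survives, and it equals l(T) c. -/
theorem anchorDefect_eq_zero_of_localTriple
    (hr : DifferentiableAt ℝ r y) (hθ : DifferentiableAt ℝ θ y)
    (hsurj : Function.Surjective (r y))
    (h : ∀ u v w : E → g, ContDiff ℝ ∞ u → ContDiff ℝ ∞ v → ContDiff ℝ ∞ w →
      localTriple r θ u v w y = 0) (a b : g) : anchorDefect r θ y a b = 0 := by
  set T := anchorDefect r θ y a b with hT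
  by_contra hne
  obtain ⟨l, hl⟩ := SeparatingDual.exists_ne_zero (R := ℝ) hne
  -- The fibre is nonzero because T ≠ 0 lies in the image of the anchor.
  obtain ⟨c, hc⟩ : ∃ c : g, c ≠ 0 := by
    obtain ⟨c, hc⟩ := hsurj T
    exact ⟨c, fun h0 => hne (by rw [← hc, h0, map_zero])⟩
  have hw : ContDiff ℝ ∞ fun z => l (z - y) • c := by fun_prop
  have h1 := h (fun _ => a) (fun _ => b) _ contDiff_const contDiff_const hw
  rw [localTriple_eq hr hθ (by fun_prop) (by fun_prop)
    (hw.contDiffAt.of_le ENat.LEInfty.out)] at h1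
  have hd : HasFDerivAt (fun z => l (z - y) • c) (l.smulRight c) y :=
    (l.hasFDerivAt.comp y ((hasFDerivAt_id y).sub_const y)).smul_const c
  rw [hd.fderiv] at h1
  simp [← hT, hl, hc] at h1

/-- Every tangent vector is an anchor value and the anchor defect already vanishes, so constant
sections detect the whole curvature. -/
theorem curvatureForm_eq_zero_of_localTriple
    (hr : DifferentiableAt ℝ r y) (hθ : DifferentiableAt ℝ θ y)
    (hsurj : Function.Surjective (r y))
    (h : ∀ u v w : E → g, ContDiff ℝ ∞ u → ContDiff ℝ ∞ v → ContDiff ℝ ∞ w →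
      localTriple r θ u v w y = 0) (k l : E) : curvatureForm θ y k l = 0 := by
  obtain ⟨a, rfl⟩ := hsurj k
  obtain ⟨b, rfl⟩ := hsurj l
  ext c
  have h1 := h (fun _ => a) (fun _ => b) (fun _ => c) contDiff_const contDiff_const contDiff_const
  rw [localTriple_eq hr hθ (by fun_prop) (by fun_prop) contDiffAt_const,
    anchorDefect_eq_zero_of_localTriple hr hθ hsurj h] at h1
  simpa using h1

end LocalProduct

/-! ### Smooth frames, the Leibniz rule in a frame, and extension of local sections. -/

section Frames

open Filter Topology Module

variable {E : Type*} [NormedAddCommGroup E] [NormedSpace ℝ E] [FiniteDimensional ℝ E]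
  {M : Type*} [TopologicalSpace M] [ChartedSpace E M] [IsManifold 𝓘(ℝ, E) ∞ M]
  {F : Type*} [NormedAddCommGroup F] [NormedSpace ℝ F] [FiniteDimensional ℝ F]
  {A : M → Type*} [TopologicalSpace (TotalSpace F A)]
  [∀ x, AddCommGroup (A x)] [∀ x, Module ℝ (A x)] [∀ x, TopologicalSpace (A x)]
  [∀ x, IsTopologicalAddGroup (A x)] [∀ x, ContinuousSMul ℝ (A x)]
  [FiberBundle F A] [VectorBundle ℝ F A] [ContMDiffVectorBundle ∞ F A 𝓘(ℝ, E)]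
  {g : Type*} [NormedAddCommGroup g] [NormedSpace ℝ g] [FiniteDimensional ℝ g]

/-- A smooth trivialization `Φ : U × g → A|_U`, given by its restrictions to the fibres. -/
structure IsFrame (E F : Type*) [NormedAddCommGroup E] [NormedSpace ℝ E]
    {M : Type*} [TopologicalSpace M] [ChartedSpace E M]
    [NormedAddCommGroup F] [NormedSpace ℝ F]
    {A : M → Type*} [TopologicalSpace (TotalSpace F A)]
    [∀ x, AddCommGroup (A x)] [∀ x, Module ℝ (A x)] [∀ x, TopologicalSpace (A x)]
    [FiberBundle F A]
    {g : Type*} [NormedAddCommGroup g] [NormedSpace ℝ g]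
    (Φ : ∀ x : M, g →ₗ[ℝ] A x) (U : Set M) : Prop where
  isOpen : IsOpen U
  bijective : ∀ x ∈ U, Function.Bijective (Φ x)
  contMDiffOn : ∀ ξ, ContMDiffOn 𝓘(ℝ, E) (𝓘(ℝ, E).prod 𝓘(ℝ, F)) ∞
    (fun x => TotalSpace.mk' F x (Φ x ξ)) U

open Classical in
/-- The inverse of a frame on each fibre on which it is bijective. -/
def frameInv (Φ : ∀ x : M, g →ₗ[ℝ] A x) (x : M) : A x →ₗ[ℝ] g :=
  if h : Function.Bijective (Φ x) then (LinearEquiv.ofBijective (Φ x) h).symm else 0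

variable {Φ : ∀ x : M, g →ₗ[ℝ] A x} {U : Set M} {x : M}

theorem IsFrame.apply_inv (hΦ : IsFrame E F Φ U) (hx : x ∈ U) (v : A x) :
    Φ x (frameInv Φ x v) = v := by
  rw [frameInv, dif_pos (hΦ.bijective x hx)]
  exact (LinearEquiv.ofBijective (Φ x) (hΦ.bijective x hx)).apply_symm_apply v

theorem IsFrame.inv_apply (hΦ : IsFrame E F Φ U) (hx : x ∈ U) (ξ : g) :
    frameInv Φ x (Φ x ξ) = ξ := by
  rw [frameInv, dif_pos (hΦ.bijective x hx)]
  exact (LinearEquiv.ofBijective (Φ x) (hΦ.bijective x hx)).symm_apply_apply ξ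

theorem frame_apply_eq_sum (Φ : ∀ x : M, g →ₗ[ℝ] A x) (u : M → g) (x : M) :
    Φ x (u x) = ∑ i, (finBasis ℝ g).repr (u x) i • Φ x (finBasis ℝ g i) := by
  conv_lhs => rw [← (finBasis ℝ g).sum_repr (u x)]
  simp only [map_sum, map_smul]

theorem contMDiffAt_repr {n : ℕ∞ω} {u : M → g}
    (hu : ContMDiffAt 𝓘(ℝ, E) 𝓘(ℝ, g) n u x) (i : Fin (finrank ℝ g)) :
    ContMDiffAt 𝓘(ℝ, E) 𝓘(ℝ, ℝ) n (fun y => (finBasis ℝ g).repr (u y) i) x :=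
  ((LinearMap.toContinuousLinearMap ((finBasis ℝ g).coord i)).contDiff.contMDiff.contMDiffAt).comp
    x hu

theorem IsFrame.contMDiffAt_apply (hΦ : IsFrame E F Φ U) (hx : x ∈ U) {n : ℕ∞ω} [ENat.LEInfty n]
    {u : M → g} (hu : ContMDiffAt 𝓘(ℝ, E) 𝓘(ℝ, g) n u x) :
    ContMDiffAt 𝓘(ℝ, E) (𝓘(ℝ, E).prod 𝓘(ℝ, F)) n
      (fun y => TotalSpace.mk' F y (Φ y (u y))) x := by
  simp_rw [frame_apply_eq_sum Φ u]
  refine ContMDiffAt.sum_section fun i _ => ?_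
  exact (contMDiffAt_repr hu i).smul_section
    (((hΦ.contMDiffOn _).contMDiffAt (hΦ.isOpen.mem_nhds hx)).of_le ENat.LEInfty.out)

/-- The coefficients of a smooth section in a smooth frame are smooth. -/
theorem IsFrame.contMDiffAt_inv (hΦ : IsFrame E F Φ U) (hx : x ∈ U) {n : ℕ∞ω} [ENat.LEInfty n]
    {X : ∀ x, A x} (hX : ContMDiffAt 𝓘(ℝ, E) (𝓘(ℝ, E).prod 𝓘(ℝ, F)) n
      (fun y => TotalSpace.mk' F y (X y)) x) :
    ContMDiffAt 𝓘(ℝ, E) 𝓘(ℝ, g) n (fun y => frameInv Φ y (X y)) x := by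
  set e := trivializationAt F A x with he
  have hxe : x ∈ e.baseSet := mem_baseSet_trivializationAt F A x
  -- The frame read in a trivialization of A: a smooth family of maps g → F, invertible near x. Its
  -- inverse is smooth because inversion of linear isomorphisms is smooth.
  set T : M → g →L[ℝ] F := fun y => ∑ i,
    (LinearMap.toContinuousLinearMap ((finBasis ℝ g).coord i)).smulRight
      (e ⟨y, Φ y (finBasis ℝ g i)⟩).2 with hT
  have hTs : ContMDiffAt 𝓘(ℝ, E) 𝓘(ℝ, g →L[ℝ] F) n T x := by
    refine contMDiffAt_finsetSum fun i _ => ?_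
    have h1 := (e.contMDiffAt_section_iff (n := ∞) hxe).mp
      ((hΦ.contMDiffOn (finBasis ℝ g i)).contMDiffAt (hΦ.isOpen.mem_nhds hx))
    exact ((ContinuousLinearMap.smulRightL ℝ g F
      (LinearMap.toContinuousLinearMap
        ((finBasis ℝ g).coord i))).contDiff.contMDiff.contMDiffAt.comp x
          (h1.of_le ENat.LEInfty.out))
  have hTe : ∀ y ∈ U ∩ e.baseSet, ∃ t : g ≃L[ℝ] F, (t : g →L[ℝ] F) = T y ∧
      ∀ v, t (frameInv Φ y v) = (e ⟨y, v⟩).2 := by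
    intro y hy
    let t := ((LinearEquiv.ofBijective (Φ y) (hΦ.bijective y hy.1)).trans
      (e.linearEquivAt ℝ y hy.2)).toContinuousLinearEquiv
    have ht : ∀ ξ, t ξ = (e ⟨y, Φ y ξ⟩).2 := fun ξ => rfl
    refine ⟨t, ?_, fun v => by rw [ht, hΦ.apply_inv hy.1]⟩
    ext ξ
    have : ξ = ∑ i, (finBasis ℝ g).repr ξ i • finBasis ℝ g i := ((finBasis ℝ g).sum_repr ξ).symm
    change t ξ = _
    conv_lhs => rw [this]
    rw [map_sum t]
    simp only [map_smul t, ht]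
    simp [hT]
  obtain ⟨t, ht, -⟩ := hTe x ⟨hx, hxe⟩
  have hinv : ContMDiffAt 𝓘(ℝ, E) 𝓘(ℝ, F →L[ℝ] g) n (fun y => (T y).inverse) x := by
    refine ContMDiffAt.comp x (g := ContinuousLinearMap.inverse) ?_ hTs
    rw [← ht]
    exact (contDiffAt_map_inverse t).contMDiffAt
  have h2 := hinv.clm_apply ((e.contMDiffAt_section_iff hxe).mp hX)
  refine h2.congr_of_eventuallyEq ?_
  filter_upwards [(hΦ.isOpen.inter e.open_baseSet).mem_nhds ⟨hx, hxe⟩] with y hy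
  obtain ⟨t, ht, hv⟩ := hTe y hy
  rw [← ht, ContinuousLinearMap.inverse_equiv, ← hv]
  simp

section Derivative

variable (cov : CovariantDerivative 𝓘(ℝ, E) F A)

theorem cov_sum {ι : Type*} (s : Finset ι) (σ : ι → ∀ x, A x)
    (h : ∀ i, MDifferentiableAt 𝓘(ℝ, E) (𝓘(ℝ, E).prod 𝓘(ℝ, F))
      (fun y => TotalSpace.mk' F y (σ i y)) x) :
    cov (fun y => ∑ i ∈ s, σ i y) x = ∑ i ∈ s, cov (σ i) x ∧
    MDifferentiableAt 𝓘(ℝ, E) (𝓘(ℝ, E).prod 𝓘(ℝ, F))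
      (fun y => TotalSpace.mk' F y (∑ i ∈ s, σ i y)) x := by
  classical
  induction s using Finset.induction_on with
  | empty =>
    simp only [Finset.sum_empty]
    exact ⟨congrFun cov.zero x, mdifferentiableAt_zeroSection ..⟩
  | insert i s hi ih =>
    simp only [Finset.sum_insert hi]
    refine ⟨?_, mdifferentiableAt_add_section (h i) ih.2⟩
    rw [← ih.1]
    exact cov.isCovariantDerivativeOnUniv.add (h i) ih.2

theorem mvfderiv_repr {u : M → g} (hu : MDifferentiableAt 𝓘(ℝ, E) 𝓘(ℝ, g) u x)
    (i : Fin (finrank ℝ g)) (w : TangentSpace 𝓘(ℝ, E) x) :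
    mvfderiv 𝓘(ℝ, E) (fun y => (finBasis ℝ g).repr (u y) i) x w =
      (finBasis ℝ g).repr (mvfderiv 𝓘(ℝ, E) u x w) i := by
  set L := LinearMap.toContinuousLinearMap ((finBasis ℝ g).coord i) with hL
  have h := mvfderiv_comp_apply (g := L) (f := u) x
    (L.differentiableAt.mdifferentiableAt) hu w
  refine h.trans ?_
  simp only [mvfderiv, mfderiv_eq_fderiv, ContinuousLinearMap.fderiv]
  rfl

/-- The Leibniz rule in a frame: `∇(Φ u) = Φ(du) + (∇Φ) u`. -/
theorem IsFrame.cov_apply (hΦ : IsFrame E F Φ U) (hx : x ∈ U)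
    {u : M → g} (hu : MDifferentiableAt 𝓘(ℝ, E) 𝓘(ℝ, g) u x) (w : TangentSpace 𝓘(ℝ, E) x) :
    cov (fun y => Φ y (u y)) x w =
      Φ x (mvfderiv 𝓘(ℝ, E) u x w) +
        ∑ i, (finBasis ℝ g).repr (u x) i • cov (fun y => Φ y (finBasis ℝ g i)) x w := by
  have hb : ∀ i, MDifferentiableAt 𝓘(ℝ, E) (𝓘(ℝ, E).prod 𝓘(ℝ, F))
      (fun y => TotalSpace.mk' F y (Φ y (finBasis ℝ g i))) x := fun i =>
    ((hΦ.contMDiffOn _).contMDiffAt (hΦ.isOpen.mem_nhds hx)).mdifferentiableAt (by simp)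
  have hc : ∀ i, MDifferentiableAt 𝓘(ℝ, E) 𝓘(ℝ, ℝ) (fun y => (finBasis ℝ g).repr (u y) i) x :=
    fun i => ((LinearMap.toContinuousLinearMap
      ((finBasis ℝ g).coord i)).differentiableAt.mdifferentiableAt).comp x hu
  have h1 := (cov_sum (x := x) cov Finset.univ
    (fun i => (fun y => (finBasis ℝ g).repr (u y) i) • fun y => Φ y (finBasis ℝ g i))
    (fun i => (hc i).smul_section (hb i))).1
  have h2 : (fun y => Φ y (u y)) = fun y => ∑ i,
      ((fun y => (finBasis ℝ g).repr (u y) i) • fun y => Φ y (finBasis ℝ g i)) y :=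
    funext fun y => frame_apply_eq_sum Φ u y
  rw [h2, h1, sum_apply]
  rw [frame_apply_eq_sum Φ (fun _ => mvfderiv 𝓘(ℝ, E) u x w) x, ← Finset.sum_add_distrib]
  refine Finset.sum_congr rfl fun i _ => ?_
  rw [show cov _ x = _ from cov.isCovariantDerivativeOnUniv.leibniz (hb i) (hc i)]
  simp only [add_apply, smul_apply, ContinuousLinearMap.smulRight_apply]
  rw [mvfderiv_repr hu, add_comm]

/-- The derivative `∇_w (Φ ξ)` of the frame. -/
theorem IsFrame.cov_const (hΦ : IsFrame E F Φ U) (hx : x ∈ U) (ξ : g)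
    (w : TangentSpace 𝓘(ℝ, E) x) :
    cov (fun y => Φ y ξ) x w =
      ∑ i, (finBasis ℝ g).repr ξ i • cov (fun y => Φ y (finBasis ℝ g i)) x w := by
  rw [hΦ.cov_apply cov hx (u := fun _ => ξ) mdifferentiableAt_const, mvfderiv_const]
  simp

/-- In the last term the coefficients are frozen at their value at x, so that term is the connection
form applied to u x. -/
theorem IsFrame.cov_apply' (hΦ : IsFrame E F Φ U) (hx : x ∈ U)
    {u : M → g} (hu : MDifferentiableAt 𝓘(ℝ, E) 𝓘(ℝ, g) u x) (w : TangentSpace 𝓘(ℝ, E) x) :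
    cov (fun y => Φ y (u y)) x w =
      Φ x (mvfderiv 𝓘(ℝ, E) u x w) + cov (fun y => Φ y (u x)) x w := by
  rw [hΦ.cov_apply cov hx hu, hΦ.cov_const cov hx]

theorem cov_congr {X Y : ∀ x, A x}
    (hX : MDifferentiableAt 𝓘(ℝ, E) (𝓘(ℝ, E).prod 𝓘(ℝ, F))
      (fun y => TotalSpace.mk' F y (X y)) x) (h : ∀ᶠ y in 𝓝 x, X y = Y y) :
    cov X x = cov Y x :=
  cov.isCovariantDerivativeOnUniv.congr_of_eventuallyEq hX
    (hX.congr_of_eventuallyEq (h.mono fun y hy => by simp [hy])) univ_mem h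

end Derivative

section Extension

variable [T2Space M]

/-- A smooth section over an open set agrees near each point with a global smooth section. -/
theorem exists_section_eventuallyEq {X : ∀ x, A x} {U : Set M} (hU : IsOpen U) (hx : x ∈ U)
    (hX : ContMDiffOn 𝓘(ℝ, E) (𝓘(ℝ, E).prod 𝓘(ℝ, F)) ∞ (fun y => TotalSpace.mk' F y (X y)) U) :
    ∃ S : Cₛ^∞⟮𝓘(ℝ, E); F, A⟯, ∀ᶠ y in 𝓝 x, S y = X y := by
  obtain ⟨ψ, -, hψ⟩ := (SmoothBumpFunction.nhds_basis_tsupport (I := 𝓘(ℝ, E)) x).mem_iff.mp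
    (hU.mem_nhds hx)
  refine ⟨⟨_, ContMDiffOn.smul_section_of_tsupport ψ.contMDiff.contMDiffOn hU hψ hX⟩, ?_⟩
  filter_upwards [ψ.eventuallyEq_one] with y hy
  change ψ y • X y = X y
  rw [hy]
  simp

/-- Smoothness of ∇ is applied to a global section that agrees with X near x; locality of ∇ carries
the result back to X. -/
theorem contMDiffAt_cov (cov : CovariantDerivative 𝓘(ℝ, E) F A)
    [h : CovariantDerivative.ContMDiffCovariantDerivative cov ∞] {X : ∀ x, A x} {U : Set M}
    (hU : IsOpen U) (hx : x ∈ U)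
    (hX : ContMDiffOn 𝓘(ℝ, E) (𝓘(ℝ, E).prod 𝓘(ℝ, F)) ∞ (fun y => TotalSpace.mk' F y (X y)) U)
    {W : ∀ x : M, TangentSpace 𝓘(ℝ, E) x}
    (hW : ContMDiffAt 𝓘(ℝ, E) 𝓘(ℝ, E).tangent ∞
      (fun y => (⟨y, W y⟩ : TangentBundle 𝓘(ℝ, E) M)) x) :
    ContMDiffAt 𝓘(ℝ, E) (𝓘(ℝ, E).prod 𝓘(ℝ, F)) ∞
      (fun y => TotalSpace.mk' F y (cov X y (W y))) x := by
  obtain ⟨S, hS⟩ := exists_section_eventuallyEq hU hx hX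
  have h1 := h.contMDiff.contMDiff (σ := fun x => S x) (by
    rw [contMDiffOn_univ]; exact S.contMDiff)
  rw [contMDiffOn_univ] at h1
  have h2 := ContMDiffAt.clm_bundle_apply (h1 x) hW
  refine h2.congr_of_eventuallyEq ?_
  filter_upwards [hS.eventually_nhds] with y hy
  have := cov_congr cov (S.mdifferentiableAt (x := y)) hy
  rw [← this]

end Extension

end Frames

/-! ### Passage from the manifold to a chart. -/

section Coordinates

open Filter Topology Module

variable {E : Type*} [NormedAddCommGroup E] [NormedSpace ℝ E] [FiniteDimensional ℝ E]
  {M : Type*} [TopologicalSpace M] [ChartedSpace E M] [IsManifold 𝓘(ℝ, E) ∞ M]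
  {F : Type*} [NormedAddCommGroup F] [NormedSpace ℝ F] [FiniteDimensional ℝ F]
  {A : M → Type*} [TopologicalSpace (TotalSpace F A)]
  [∀ x, AddCommGroup (A x)] [∀ x, Module ℝ (A x)] [∀ x, TopologicalSpace (A x)]
  [∀ x, IsTopologicalAddGroup (A x)] [∀ x, ContinuousSMul ℝ (A x)]
  [FiberBundle F A] [VectorBundle ℝ F A] [ContMDiffVectorBundle ∞ F A 𝓘(ℝ, E)]
  {g : Type*} [NormedAddCommGroup g] [NormedSpace ℝ g] [FiniteDimensional ℝ g]

/-- The image of an open set under the chart at `x₀`. -/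
def coordDomain (x₀ : M) (U : Set M) : Set E :=
  (extChartAt 𝓘(ℝ, E) x₀).target ∩ (extChartAt 𝓘(ℝ, E) x₀).symm ⁻¹' U

/-- The trivialization of `TM` over the chart at `x₀`, on each tangent space. -/
def tangentCoord (x₀ x : M) : TangentSpace 𝓘(ℝ, E) x →L[ℝ] E :=
  (trivializationAt E (TangentSpace 𝓘(ℝ, E)) x₀).continuousLinearMapAt ℝ x

/-- The inverse of `tangentCoord`. -/
def tangentCoordSymm (x₀ x : M) : E →L[ℝ] TangentSpace 𝓘(ℝ, E) x :=
  (trivializationAt E (TangentSpace 𝓘(ℝ, E)) x₀).symmL ℝ x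

/-- The coordinate expression of a section of `A` in a frame and the chart at `x₀`. -/
def coordSection (Φ : ∀ x : M, g →ₗ[ℝ] A x) (x₀ : M) (X : ∀ x, A x) : E → g :=
  fun y => frameInv Φ ((extChartAt 𝓘(ℝ, E) x₀).symm y) (X ((extChartAt 𝓘(ℝ, E) x₀).symm y))

/-- The coordinate expression of the anchor in a frame and the chart at `x₀`. -/
def coordAnchor (ρ : Anchor 𝓘(ℝ, E) F A) (Φ : ∀ x : M, g →ₗ[ℝ] A x) (x₀ : M) (y : E) :
    g →L[ℝ] E :=
  LinearMap.toContinuousLinearMap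
    ((tangentCoord x₀ ((extChartAt 𝓘(ℝ, E) x₀).symm y)).toLinearMap ∘ₗ
      (ρ.toFun ((extChartAt 𝓘(ℝ, E) x₀).symm y)).toLinearMap ∘ₗ
      Φ ((extChartAt 𝓘(ℝ, E) x₀).symm y))

/-- The connection form in a frame and the chart at `x₀`. -/
def coordForm (cov : CovariantDerivative 𝓘(ℝ, E) F A) (Φ : ∀ x : M, g →ₗ[ℝ] A x) (x₀ : M)
    (y : E) : E →L[ℝ] g →L[ℝ] g :=
  LinearMap.toContinuousLinearMap (∑ i,
    (ContinuousLinearMap.smulRightL ℝ g g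
      (LinearMap.toContinuousLinearMap ((finBasis ℝ g).coord i))).toLinearMap ∘ₗ
      frameInv Φ ((extChartAt 𝓘(ℝ, E) x₀).symm y) ∘ₗ
      (cov (fun z => Φ z (finBasis ℝ g i)) ((extChartAt 𝓘(ℝ, E) x₀).symm y)).toLinearMap ∘ₗ
      (tangentCoordSymm x₀ ((extChartAt 𝓘(ℝ, E) x₀).symm y)).toLinearMap)

variable {Φ : ∀ x : M, g →ₗ[ℝ] A x} {U : Set M} {x₀ x : M} {y : E}

theorem isOpen_coordDomain (hU : IsOpen U) : IsOpen (coordDomain (E := E) x₀ U) :=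
  (continuousOn_extChartAt_symm x₀).isOpen_inter_preimage (isOpen_extChartAt_target x₀) hU

theorem symm_mem_of_mem_coordDomain (hy : y ∈ coordDomain x₀ U) :
    (extChartAt 𝓘(ℝ, E) x₀).symm y ∈ U ∩ (chartAt E x₀).source :=
  ⟨hy.2, by simpa only [extChartAt_source] using (extChartAt 𝓘(ℝ, E) x₀).map_target hy.1⟩

theorem mem_coordDomain (hx : x ∈ U) (hx' : x ∈ (chartAt E x₀).source) :
    extChartAt 𝓘(ℝ, E) x₀ x ∈ coordDomain x₀ U := by
  have h : x ∈ (extChartAt 𝓘(ℝ, E) x₀).source := by rwa [extChartAt_source]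
  refine ⟨(extChartAt 𝓘(ℝ, E) x₀).map_source h, ?_⟩
  rwa [mem_preimage, (extChartAt 𝓘(ℝ, E) x₀).left_inv h]

theorem tangentCoord_symm (hx : x ∈ (chartAt E x₀).source) (w : E) :
    tangentCoord x₀ x (tangentCoordSymm x₀ x w) = w :=
  (trivializationAt E (TangentSpace 𝓘(ℝ, E)) x₀).continuousLinearMapAt_symmL (by simpa using hx) w

theorem tangentCoordSymm_coord (hx : x ∈ (chartAt E x₀).source) (w : TangentSpace 𝓘(ℝ, E) x) :
    tangentCoordSymm x₀ x (tangentCoord x₀ x w) = w :=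
  (trivializationAt E (TangentSpace 𝓘(ℝ, E)) x₀).symmL_continuousLinearMapAt (by simpa using hx) w

theorem contDiffOn_comp_symm {G : Type*} [NormedAddCommGroup G] [NormedSpace ℝ G] {f : M → G}
    (hf : ∀ x ∈ U ∩ (chartAt E x₀).source, ContMDiffAt 𝓘(ℝ, E) 𝓘(ℝ, G) ∞ f x) :
    ContDiffOn ℝ ∞ (fun y => f ((extChartAt 𝓘(ℝ, E) x₀).symm y)) (coordDomain x₀ U) := by
  rw [← contMDiffOn_iff_contDiffOn]
  intro y hy
  exact (hf _ (symm_mem_of_mem_coordDomain hy)).comp_contMDiffWithinAt y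
    ((contMDiffOn_extChartAt_symm x₀ y hy.1).mono inter_subset_left)

/-- The map `tangentCoord x₀ x` is the differential of the chart at x, so this is the chain rule. -/
theorem mvfderiv_eq_fderiv (hx : x ∈ (chartAt E x₀).source) {u : M → g}
    (hu : MDifferentiableAt 𝓘(ℝ, E) 𝓘(ℝ, g) u x) (v : TangentSpace 𝓘(ℝ, E) x) :
    mvfderiv 𝓘(ℝ, E) u x v =
      fderiv ℝ (fun y => u ((extChartAt 𝓘(ℝ, E) x₀).symm y)) (extChartAt 𝓘(ℝ, E) x₀ x)
        (tangentCoord x₀ x v) := by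
  have hs : x ∈ (extChartAt 𝓘(ℝ, E) x₀).source := by rwa [extChartAt_source]
  set φ := extChartAt 𝓘(ℝ, E) x₀
  have hφ : MDifferentiableAt 𝓘(ℝ, E) 𝓘(ℝ, E) φ x := mdifferentiableAt_extChartAt hx
  have hφs : MDifferentiableAt 𝓘(ℝ, E) 𝓘(ℝ, E) φ.symm (φ x) :=
    ((contMDiffOn_extChartAt_symm (n := ∞) x₀).contMDiffAt
      ((isOpen_extChartAt_target x₀).mem_nhds (φ.map_source hs))).mdifferentiableAt (by simp)
  have hcomp : MDifferentiableAt 𝓘(ℝ, E) 𝓘(ℝ, g) (u ∘ φ.symm) (φ x) :=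
    MDifferentiableAt.comp (φ x) (by rwa [φ.left_inv hs]) hφs
  have he : u =ᶠ[𝓝 x] (u ∘ φ.symm) ∘ φ := by
    filter_upwards [extChartAt_source_mem_nhds' (I := 𝓘(ℝ, E)) hs] with z hz
    simp [φ.left_inv hz]
  have h1 : mfderiv 𝓘(ℝ, E) 𝓘(ℝ, g) u x = mfderiv 𝓘(ℝ, E) 𝓘(ℝ, g) ((u ∘ φ.symm) ∘ φ) x :=
    he.mfderiv_eq
  have h2 := mfderiv_comp_apply x hcomp hφ v
  have h3 : tangentCoord x₀ x = mfderiv 𝓘(ℝ, E) 𝓘(ℝ, E) φ x :=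
    TangentBundle.continuousLinearMapAt_trivializationAt hx
  rw [mfderiv_eq_fderiv] at h2
  rw [h3]
  refine Eq.trans ?_ h2
  rw [← h1]
  rfl

theorem coordAnchor_apply (ρ : Anchor 𝓘(ℝ, E) F A) (hx : x ∈ (chartAt E x₀).source) (ξ : g) :
    coordAnchor ρ Φ x₀ (extChartAt 𝓘(ℝ, E) x₀ x) ξ = tangentCoord x₀ x (ρ.toFun x (Φ x ξ)) := by
  have hs : x ∈ (extChartAt 𝓘(ℝ, E) x₀).source := by rwa [extChartAt_source]
  rw [coordAnchor, (extChartAt 𝓘(ℝ, E) x₀).left_inv hs]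
  rfl

theorem coordForm_apply (cov : CovariantDerivative 𝓘(ℝ, E) F A) (hΦ : IsFrame E F Φ U)
    (hxU : x ∈ U) (hx : x ∈ (chartAt E x₀).source) (w : E) (ξ : g) :
    coordForm cov Φ x₀ (extChartAt 𝓘(ℝ, E) x₀ x) w ξ =
      frameInv Φ x (cov (fun z => Φ z ξ) x (tangentCoordSymm x₀ x w)) := by
  have hs : x ∈ (extChartAt 𝓘(ℝ, E) x₀).source := by rwa [extChartAt_source]
  rw [coordForm, (extChartAt 𝓘(ℝ, E) x₀).left_inv hs, hΦ.cov_const cov hxU]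
  simp

theorem contDiffOn_coordAnchor (ρ : Anchor 𝓘(ℝ, E) F A) (hΦ : IsFrame E F Φ U) :
    ContDiffOn ℝ ∞ (coordAnchor ρ Φ x₀) (coordDomain x₀ U) := by
  rw [contDiffOn_clm_apply]
  intro ξ
  refine contDiffOn_comp_symm (f := fun x => tangentCoord x₀ x (ρ.toFun x (Φ x ξ))) ?_
  intro x hx
  have hb : x ∈ (trivializationAt E (TangentSpace 𝓘(ℝ, E) (M := M)) x₀).baseSet := by
    simpa using hx.2
  have h1 : ContMDiffAt 𝓘(ℝ, E) 𝓘(ℝ, E).tangent ∞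
      (fun y => (⟨y, ρ.toFun y (Φ y ξ)⟩ : TangentBundle 𝓘(ℝ, E) M)) x :=
    (ρ.smooth _).comp x ((hΦ.contMDiffOn ξ).contMDiffAt (hΦ.isOpen.mem_nhds hx.1))
  refine (((trivializationAt E (TangentSpace 𝓘(ℝ, E) (M := M)) x₀).contMDiffAt_section_iff
    hb).mp h1).congr_of_eventuallyEq ?_
  filter_upwards [(trivializationAt E (TangentSpace 𝓘(ℝ, E) (M := M)) x₀).open_baseSet.mem_nhds
    hb] with z hz
  rw [tangentCoord, Trivialization.continuousLinearMapAt_apply,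
    Trivialization.linearMapAt_apply, if_pos hz]

theorem contMDiffAt_tangentCoordSymm (hx : x ∈ (chartAt E x₀).source) (w : E) :
    ContMDiffAt 𝓘(ℝ, E) 𝓘(ℝ, E).tangent ∞
      (fun y => (⟨y, tangentCoordSymm x₀ y w⟩ : TangentBundle 𝓘(ℝ, E) M)) x := by
  set τ := trivializationAt E (TangentSpace 𝓘(ℝ, E) (M := M)) x₀ with hτ
  have hb : x ∈ τ.baseSet := by simpa [hτ] using hx
  refine (τ.contMDiffAt_section_iff hb).mpr
    ((contMDiffAt_const (c := w)).congr_of_eventuallyEq ?_)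
  filter_upwards [τ.open_baseSet.mem_nhds hb] with z hz
  rw [tangentCoordSymm, Trivialization.symmL_apply _ hz, τ.apply_mk_symm hz]

theorem contDiffOn_coordForm [T2Space M] (cov : CovariantDerivative 𝓘(ℝ, E) F A)
    [CovariantDerivative.ContMDiffCovariantDerivative cov ∞] (hΦ : IsFrame E F Φ U) :
    ContDiffOn ℝ ∞ (coordForm cov Φ x₀) (coordDomain x₀ U) := by
  rw [contDiffOn_clm_apply]
  intro w
  rw [contDiffOn_clm_apply]
  intro ξ
  refine (contDiffOn_comp_symm (U := U) (f := fun x =>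
    frameInv Φ x (cov (fun z => Φ z ξ) x (tangentCoordSymm x₀ x w))) ?_).congr ?_
  · intro x hx
    exact hΦ.contMDiffAt_inv hx.1 (contMDiffAt_cov cov hΦ.isOpen hx.1 (hΦ.contMDiffOn ξ)
      (contMDiffAt_tangentCoordSymm hx.2 w))
  · intro y hy
    have h := symm_mem_of_mem_coordDomain hy
    rw [← coordForm_apply cov hΦ h.1 h.2, (extChartAt 𝓘(ℝ, E) x₀).right_inv hy.1]

theorem contDiffOn_coordSection (hΦ : IsFrame E F Φ U) (X : Cₛ^∞⟮𝓘(ℝ, E); F, A⟯) :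
    ContDiffOn ℝ ∞ (coordSection (E := E) Φ x₀ X) (coordDomain x₀ U) :=
  contDiffOn_comp_symm fun x hx => hΦ.contMDiffAt_inv hx.1 (X.contMDiff x)

theorem coordSection_apply (X : ∀ x, A x) (hx : x ∈ (chartAt E x₀).source) :
    coordSection Φ x₀ X (extChartAt 𝓘(ℝ, E) x₀ x) = frameInv Φ x (X x) := by
  have hs : x ∈ (extChartAt 𝓘(ℝ, E) x₀).source := by rwa [extChartAt_source]
  rw [coordSection, (extChartAt 𝓘(ℝ, E) x₀).left_inv hs]

/-- In a frame and a chart, ∇ becomes d + θ with θ = `coordForm`; this is the Leibniz rule for the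
coefficients of Y. -/
theorem coordSection_rawProd (ρ : Anchor 𝓘(ℝ, E) F A) (cov : CovariantDerivative 𝓘(ℝ, E) F A)
    (hΦ : IsFrame E F Φ U) (X Y : Cₛ^∞⟮𝓘(ℝ, E); F, A⟯) (hy : y ∈ coordDomain x₀ U) :
    coordSection Φ x₀ (rawProd ρ cov X Y) y =
      localProd (coordAnchor ρ Φ x₀) (coordForm cov Φ x₀) (coordSection Φ x₀ X)
        (coordSection Φ x₀ Y) y := by
  obtain ⟨hxU, hx⟩ := symm_mem_of_mem_coordDomain hy
  have hyx := (extChartAt 𝓘(ℝ, E) x₀).right_inv hy.1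
  set x := (extChartAt 𝓘(ℝ, E) x₀).symm y with hxdef
  rw [← hyx, localProd, coordSection_apply _ hx, coordSection_apply _ hx, coordSection_apply _ hx,
    coordAnchor_apply ρ hx, hΦ.apply_inv hxU, coordForm_apply cov hΦ hxU hx,
    tangentCoordSymm_coord hx]
  have hu : ContMDiffAt 𝓘(ℝ, E) 𝓘(ℝ, g) ∞ (fun z => frameInv Φ z (Y z)) x :=
    hΦ.contMDiffAt_inv hxU (Y.contMDiff x)
  have hu' := hu.mdifferentiableAt (by simp)
  have h1 : cov Y x = cov (fun z => Φ z (frameInv Φ z (Y z))) x :=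
    cov_congr cov Y.mdifferentiableAt (by
      filter_upwards [hΦ.isOpen.mem_nhds hxU] with z hz
      rw [hΦ.apply_inv hz])
  rw [rawProd, h1, hΦ.cov_apply' cov hxU hu', map_add, hΦ.inv_apply hxU, mvfderiv_eq_fderiv hx hu']
  rfl

theorem localProd_congr {r : E → g →L[ℝ] E} {θ : E → E →L[ℝ] g →L[ℝ] g} {u u' v v' : E → g}
    (hu : u y = u' y) (hv : v =ᶠ[𝓝 y] v') : localProd r θ u v y = localProd r θ u' v' y := by
  rw [localProd, localProd, hu, hv.fderiv_eq, hv.eq_of_nhds]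

/-- In the nested products, a factor that gets differentiated is matched as a germ at y, while the
differentiating factor is matched only at y itself. -/
theorem coordSection_tripleBracket (ρ : Anchor 𝓘(ℝ, E) F A)
    (cov : CovariantDerivative 𝓘(ℝ, E) F A)
    [CovariantDerivative.ContMDiffCovariantDerivative cov ∞]
    (hΦ : IsFrame E F Φ U) (X Y Z : Cₛ^∞⟮𝓘(ℝ, E); F, A⟯) (hy : y ∈ coordDomain x₀ U) :
    coordSection Φ x₀ ((inducedConnection ρ cov).tripleBracket X Y Z) y =
      localTriple (coordAnchor ρ Φ x₀) (coordForm cov Φ x₀) (coordSection Φ x₀ X)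
        (coordSection Φ x₀ Y) (coordSection Φ x₀ Z) y := by
  set D := inducedConnection ρ cov with hD
  have hprod : ∀ S T : Cₛ^∞⟮𝓘(ℝ, E); F, A⟯, ∀ z ∈ coordDomain x₀ U,
      coordSection Φ x₀ (D.toFun S T) z =
        localProd (coordAnchor ρ Φ x₀) (coordForm cov Φ x₀) (coordSection Φ x₀ S)
          (coordSection Φ x₀ T) z := fun S T z hz => coordSection_rawProd ρ cov hΦ S T hz
  have hev : ∀ S T : Cₛ^∞⟮𝓘(ℝ, E); F, A⟯, coordSection Φ x₀ (D.toFun S T) =ᶠ[𝓝 y]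
        localProd (coordAnchor ρ Φ x₀) (coordForm cov Φ x₀) (coordSection Φ x₀ S)
          (coordSection Φ x₀ T) := fun S T => by
    filter_upwards [(isOpen_coordDomain hΦ.isOpen).mem_nhds hy] with z hz using hprod S T z hz
  have hsub : coordSection Φ x₀ (D.tripleBracket X Y Z) y =
      coordSection Φ x₀ (D.toFun X (D.toFun Y Z)) y - coordSection Φ x₀ (D.toFun (D.toFun X Y) Z) y -
      (coordSection Φ x₀ (D.toFun Y (D.toFun X Z)) y -
        coordSection Φ x₀ (D.toFun (D.toFun Y X) Z) y) := by
    simp only [coordSection]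
    rw [← map_sub, ← map_sub, ← map_sub]
    rfl
  rw [hsub, localTriple, hprod _ _ y hy, hprod _ _ y hy, hprod _ _ y hy, hprod _ _ y hy,
    localProd_congr rfl (hev Y Z), localProd_congr rfl (hev X Z),
    localProd_congr (hprod X Y y hy) (EventuallyEq.refl _ _),
    localProd_congr (hprod Y X y hy) (EventuallyEq.refl _ _)]

/-- The pre-Lie identity concerns global sections, so the test functions used in coordinates must be
realised, as germs, by global sections. -/
theorem exists_coordSection_eventuallyEq [T2Space M] (hΦ : IsFrame E F Φ U)
    (hy : y ∈ coordDomain x₀ U) {u : E → g} (hu : ContDiff ℝ ∞ u) :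
    ∃ S : Cₛ^∞⟮𝓘(ℝ, E); F, A⟯, coordSection Φ x₀ S =ᶠ[𝓝 y] u := by
  have h := symm_mem_of_mem_coordDomain hy
  have hO : IsOpen (U ∩ (chartAt E x₀).source) := hΦ.isOpen.inter (chartAt E x₀).open_source
  obtain ⟨S, hS⟩ := exists_section_eventuallyEq (X := fun z => Φ z (u (extChartAt 𝓘(ℝ, E) x₀ z)))
    hO h (fun z hz => (hΦ.contMDiffAt_apply hz.1 (u := fun z => u (extChartAt 𝓘(ℝ, E) x₀ z))
      (hu.contMDiff.contMDiffAt.comp z (contMDiffAt_extChartAt' hz.2))).contMDiffWithinAt)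
  refine ⟨S, ?_⟩
  have hc : ContinuousAt (extChartAt 𝓘(ℝ, E) x₀).symm y :=
    (continuousOn_extChartAt_symm x₀).continuousAt ((isOpen_extChartAt_target x₀).mem_nhds hy.1)
  filter_upwards [hc.eventually hS, (isOpen_coordDomain hΦ.isOpen).mem_nhds hy] with z hz hz'
  rw [coordSection, hz, hΦ.inv_apply (symm_mem_of_mem_coordDomain hz').1,
    (extChartAt 𝓘(ℝ, E) x₀).right_inv hz'.1]

end Coordinates

/-! ### Local existence and rigidity of parallel frames. -/

section ParallelFrames

open Filter Topology Module

variable {E : Type*} [NormedAddCommGroup E] [NormedSpace ℝ E] [FiniteDimensional ℝ E]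
  {M : Type*} [TopologicalSpace M] [ChartedSpace E M] [IsManifold 𝓘(ℝ, E) ∞ M]
  {F : Type*} [NormedAddCommGroup F] [NormedSpace ℝ F] [FiniteDimensional ℝ F]
  {A : M → Type*} [TopologicalSpace (TotalSpace F A)]
  [∀ x, AddCommGroup (A x)] [∀ x, Module ℝ (A x)] [∀ x, TopologicalSpace (A x)]
  [∀ x, IsTopologicalAddGroup (A x)] [∀ x, ContinuousSMul ℝ (A x)]
  [FiberBundle F A] [VectorBundle ℝ F A] [ContMDiffVectorBundle ∞ F A 𝓘(ℝ, E)]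
  {g : Type*} [NormedAddCommGroup g] [NormedSpace ℝ g] [FiniteDimensional ℝ g]

variable {Φ : ∀ x : M, g →ₗ[ℝ] A x} {U : Set M} {x₀ x : M}

/-- The constant sections of a frame are parallel over `U`. -/
def IsParallelFrame (cov : CovariantDerivative 𝓘(ℝ, E) F A) (Φ : ∀ x : M, g →ₗ[ℝ] A x)
    (U : Set M) : Prop :=
  ∀ ξ, ∀ x ∈ U, cov (fun y => Φ y ξ) x = 0

/-- The frame given by the preferred trivialization at a point. -/
def trivializationFrame (F : Type*) [NormedAddCommGroup F] [NormedSpace ℝ F]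
    {A : M → Type*} [TopologicalSpace (TotalSpace F A)]
    [∀ x, AddCommGroup (A x)] [∀ x, Module ℝ (A x)] [∀ x, TopologicalSpace (A x)]
    [FiberBundle F A] [VectorBundle ℝ F A] (x₀ x : M) : F →ₗ[ℝ] A x :=
  ((trivializationAt F A x₀).symmL ℝ x).toLinearMap

theorem isFrame_trivializationFrame (x₀ : M) :
    IsFrame E F (trivializationFrame F (A := A) x₀) (trivializationAt F A x₀).baseSet where
  isOpen := (trivializationAt F A x₀).open_baseSet
  bijective x hx := by
    have := ((trivializationAt F A x₀).continuousLinearEquivAt ℝ x hx).symm.bijective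
    rwa [(trivializationAt F A x₀).symm_continuousLinearEquivAt_eq hx] at this
  contMDiffOn ξ := by
    rw [(trivializationAt F A x₀).contMDiffOn_section_baseSet_iff]
    refine (contMDiffOn_const (c := ξ)).congr fun x hx => ?_
    rw [trivializationFrame, ContinuousLinearMap.coe_coe, Trivialization.symmL_apply _ hx,
      (trivializationAt F A x₀).apply_mk_symm hx]

/-- The pre-Lie identity in a frame and a chart. -/
theorem localTriple_coord_eq_zero [T2Space M] {ρ : Anchor 𝓘(ℝ, E) F A}
    {cov : CovariantDerivative 𝓘(ℝ, E) F A}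
    [CovariantDerivative.ContMDiffCovariantDerivative cov ∞]
    (h : (inducedConnection ρ cov).IsPreLieAlgebroid) (hΦ : IsFrame E F Φ U) {y : E}
    (hy : y ∈ coordDomain x₀ U) {u v w : E → g} (hu : ContDiff ℝ ∞ u) (hv : ContDiff ℝ ∞ v)
    (hw : ContDiff ℝ ∞ w) :
    localTriple (coordAnchor ρ Φ x₀) (coordForm cov Φ x₀) u v w y = 0 := by
  obtain ⟨X, hX⟩ := exists_coordSection_eventuallyEq hΦ hy hu
  obtain ⟨Y, hY⟩ := exists_coordSection_eventuallyEq hΦ hy hv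
  obtain ⟨Z, hZ⟩ := exists_coordSection_eventuallyEq hΦ hy hw
  have hnhds := (isOpen_coordDomain (E := E) (x₀ := x₀) hΦ.isOpen).mem_nhds hy
  have hr := ((contDiffOn_coordAnchor (x₀ := x₀) ρ hΦ).contDiffAt hnhds).differentiableAt
    (by simp)
  have hθ := ((contDiffOn_coordForm (x₀ := x₀) cov hΦ).contDiffAt hnhds).differentiableAt
    (by simp)
  have hs : ∀ S : Cₛ^∞⟮𝓘(ℝ, E); F, A⟯, ContDiffAt ℝ ∞ (coordSection (E := E) Φ x₀ S) y :=
    fun S => (contDiffOn_coordSection hΦ S).contDiffAt hnhds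
  have h0 : coordSection Φ x₀ ((inducedConnection ρ cov).tripleBracket X Y Z) y = 0 := by
    rw [h X Y Z]
    exact map_zero (frameInv Φ _)
  -- By `localTriple_eq` both triple brackets depend only on values and first derivatives at y,
  -- where the global sections agree with u, v, w.
  rw [coordSection_tripleBracket ρ cov hΦ X Y Z hy, localTriple_eq hr hθ
    ((hs X).differentiableAt (by simp)) ((hs Y).differentiableAt (by simp))
    ((hs Z).of_le ENat.LEInfty.out), hX.eq_of_nhds, hY.eq_of_nhds, hZ.eq_of_nhds,
    hZ.fderiv_eq] at h0
  rw [localTriple_eq hr hθ (hu.contDiffAt.differentiableAt (by simp))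
    (hv.contDiffAt.differentiableAt (by simp)) (hw.contDiffAt.of_le ENat.LEInfty.out), h0]

theorem surjective_coordAnchor {ρ : Anchor 𝓘(ℝ, E) F A} (hρ : ρ.Transitive)
    (hΦ : IsFrame E F Φ U) {y : E} (hy : y ∈ coordDomain x₀ U) :
    Function.Surjective (coordAnchor ρ Φ x₀ y) := by
  intro w
  have h := symm_mem_of_mem_coordDomain hy
  obtain ⟨v, hv⟩ := hρ _ (tangentCoordSymm x₀ ((extChartAt 𝓘(ℝ, E) x₀).symm y) w)
  obtain ⟨ξ, rfl⟩ := (hΦ.bijective _ h.1).2 v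
  refine ⟨ξ, ?_⟩
  conv_lhs => rw [← (extChartAt 𝓘(ℝ, E) x₀).right_inv hy.1]
  rw [coordAnchor_apply ρ h.2, hv, tangentCoord_symm h.2]

theorem anchorDefect_coord_eq_zero [T2Space M] {ρ : Anchor 𝓘(ℝ, E) F A} (hρ : ρ.Transitive)
    {cov : CovariantDerivative 𝓘(ℝ, E) F A}
    [CovariantDerivative.ContMDiffCovariantDerivative cov ∞]
    (h : (inducedConnection ρ cov).IsPreLieAlgebroid) (hΦ : IsFrame E F Φ U) {y : E}
    (hy : y ∈ coordDomain x₀ U) (a b : g) :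
    anchorDefect (coordAnchor ρ Φ x₀) (coordForm cov Φ x₀) y a b = 0 := by
  have hnhds := (isOpen_coordDomain (E := E) (x₀ := x₀) hΦ.isOpen).mem_nhds hy
  exact anchorDefect_eq_zero_of_localTriple
    (((contDiffOn_coordAnchor ρ hΦ).contDiffAt hnhds).differentiableAt (by simp))
    (((contDiffOn_coordForm cov hΦ).contDiffAt hnhds).differentiableAt (by simp))
    (surjective_coordAnchor hρ hΦ hy)
    (fun _ _ _ hu hv hw => localTriple_coord_eq_zero h hΦ hy hu hv hw) a b

theorem curvatureForm_coord_eq_zero [T2Space M] {ρ : Anchor 𝓘(ℝ, E) F A} (hρ : ρ.Transitive)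
    {cov : CovariantDerivative 𝓘(ℝ, E) F A}
    [CovariantDerivative.ContMDiffCovariantDerivative cov ∞]
    (h : (inducedConnection ρ cov).IsPreLieAlgebroid) (hΦ : IsFrame E F Φ U) {y : E}
    (hy : y ∈ coordDomain x₀ U) (k l : E) :
    curvatureForm (coordForm cov Φ x₀) y k l = 0 := by
  have hnhds := (isOpen_coordDomain (E := E) (x₀ := x₀) hΦ.isOpen).mem_nhds hy
  exact curvatureForm_eq_zero_of_localTriple
    (((contDiffOn_coordAnchor ρ hΦ).contDiffAt hnhds).differentiableAt (by simp))
    (((contDiffOn_coordForm cov hΦ).contDiffAt hnhds).differentiableAt (by simp))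
    (surjective_coordAnchor hρ hΦ hy)
    (fun _ _ _ hu hv hw => localTriple_coord_eq_zero h hΦ hy hu hv hw) k l

theorem coordForm_eq_zero {cov : CovariantDerivative 𝓘(ℝ, E) F A} (hΦ : IsFrame E F Φ U)
    (hpar : IsParallelFrame cov Φ U) {y : E} (hy : y ∈ coordDomain x₀ U) :
    coordForm cov Φ x₀ y = 0 := by
  have h := symm_mem_of_mem_coordDomain hy
  ext w ξ
  rw [← (extChartAt 𝓘(ℝ, E) x₀).right_inv hy.1, coordForm_apply cov hΦ h.1 h.2, hpar _ _ h.1]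
  exact map_zero (frameInv Φ _)

/-- A connection satisfying the pre-Lie identity has parallel frames near every point. -/
theorem exists_parallelFrame [T2Space M] {ρ : Anchor 𝓘(ℝ, E) F A} (hρ : ρ.Transitive)
    {cov : CovariantDerivative 𝓘(ℝ, E) F A}
    [CovariantDerivative.ContMDiffCovariantDerivative cov ∞]
    (h : (inducedConnection ρ cov).IsPreLieAlgebroid) (x₀ : M) :
    ∃ (U : Set M) (Φ : ∀ x : M, F →ₗ[ℝ] A x), x₀ ∈ U ∧ IsFrame E F Φ U ∧
      IsParallelFrame cov Φ U := by
  set Φ := trivializationFrame F (A := A) x₀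
  set U := (trivializationAt F A x₀).baseSet
  have hΦ : IsFrame E F Φ U := isFrame_trivializationFrame x₀
  have hx₀ : x₀ ∈ U := mem_baseSet_trivializationAt F A x₀
  -- Here the algebra is `F →L[ℝ] F`, and P is the gauge transformation turning the trivialization
  -- frame Φ into the parallel frame Φ ∘ P.
  obtain ⟨V, hVU, hVo, hV0, P, hP, hPu, hPd⟩ := exists_isUnit_parallel
    (isOpen_coordDomain hΦ.isOpen) (mem_coordDomain hx₀ (mem_chart_source E x₀))
    (contDiffOn_coordForm cov hΦ) (fun y hy => curvatureForm_coord_eq_zero hρ h hΦ hy)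
  set φ := extChartAt 𝓘(ℝ, E) x₀ with hφ
  set W := U ∩ ((chartAt E x₀).source ∩ φ ⁻¹' V) with hW
  have hso : IsOpen ((chartAt E x₀).source ∩ φ ⁻¹' V) := by
    have := (continuousOn_extChartAt (I := 𝓘(ℝ, E)) x₀).isOpen_inter_preimage
      (isOpen_extChartAt_source x₀) hVo
    rwa [extChartAt_source] at this
  have hsm : ∀ ξ, ∀ x ∈ W,
      ContMDiffAt 𝓘(ℝ, E) 𝓘(ℝ, F) ∞ (fun z => P (φ z) ξ) x := fun ξ x hx => by
    have h1 : ContDiffAt ℝ ∞ (fun y => P y ξ) (φ x) :=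
      (hP.contDiffAt (hVo.mem_nhds hx.2.2)).clm_apply contDiffAt_const
    exact h1.contMDiffAt.comp x (contMDiffAt_extChartAt' hx.2.1)
  refine ⟨W, fun x => Φ x ∘ₗ (P (φ x)).toLinearMap,
    ⟨hx₀, mem_chart_source E x₀, hV0⟩, ⟨hΦ.isOpen.inter hso, fun x hx => ?_, fun ξ x hx => ?_⟩,
    fun ξ x hx => ?_⟩
  · obtain ⟨p, hp⟩ := hPu _ hx.2.2
    refine (hΦ.bijective x hx.1).comp ?_
    rw [← hp]
    exact (ContinuousLinearEquiv.unitsEquiv ℝ F p).bijective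
  · exact (hΦ.contMDiffAt_apply hx.1 (hsm ξ x hx)).contMDiffWithinAt
  · ext w
    have hu := (hsm ξ x hx).mdifferentiableAt (by simp)
    have h1 := hΦ.cov_apply' cov hx.1 hu w
    have hinj : Function.Injective (frameInv Φ x) := fun v v' hv => by
      rw [← hΦ.apply_inv hx.1 v, hv, hΦ.apply_inv hx.1]
    have hs : x ∈ φ.source := by rw [hφ, extChartAt_source]; exact hx.2.1
    have hev : (fun y => P (φ (φ.symm y)) ξ) =ᶠ[𝓝 (φ x)] fun y => P y ξ := by
      filter_upwards [(isOpen_extChartAt_target x₀).mem_nhds (φ.map_source hs)] with y hy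
      rw [φ.right_inv hy]
    have hd : HasFDerivAt (fun y => P y ξ)
        ((parallelDeriv (coordForm cov Φ x₀) (φ x) (P (φ x))).flip ξ) (φ x) := by
      have := (hPd _ hx.2.2).clm_apply (hasFDerivAt_const ξ (φ x))
      simpa using this
    apply hinj
    change frameInv Φ x (cov (fun z => Φ z (P (φ z) ξ)) x w) = frameInv Φ x 0
    -- The coefficients of ∇(Φ P ξ) are dP ξ + θ P ξ, which vanish because dP = -θP.
    rw [h1, map_add, hΦ.inv_apply hx.1, mvfderiv_eq_fderiv hx.2.1 hu, hev.fderiv_eq, hd.fderiv,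
      map_zero]
    conv_lhs => enter [2]; rw [← tangentCoordSymm_coord hx.2.1 w]
    rw [← coordForm_apply cov hΦ hx.1 hx.2.1, ContinuousLinearMap.flip_apply, parallelDeriv_apply]
    exact neg_add_cancel _

/-- Two parallel frames differ by a locally constant map. -/
theorem eventually_transition_eq {g' : Type*} [NormedAddCommGroup g'] [NormedSpace ℝ g']
    [FiniteDimensional ℝ g'] {cov : CovariantDerivative 𝓘(ℝ, E) F A}
    {Φ' : ∀ x : M, g' →ₗ[ℝ] A x} {U' : Set M}
    (hΦ : IsFrame E F Φ U) (hpar : IsParallelFrame cov Φ U)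
    (hΦ' : IsFrame E F Φ' U') (hpar' : IsParallelFrame cov Φ' U') (hx : x ∈ U ∩ U') :
    ∀ᶠ y in 𝓝 x, frameInv Φ' y ∘ₗ Φ y = frameInv Φ' x ∘ₗ Φ x := by
  set W := U ∩ U'
  have hWo : IsOpen W := hΦ.isOpen.inter hΦ'.isOpen
  have key : ∀ ξ, ∀ᶠ y in 𝓝 x, frameInv Φ' y (Φ y ξ) = frameInv Φ' x (Φ x ξ) := by
    intro ξ
    set u : M → g' := fun y => frameInv Φ' y (Φ y ξ) with hu
    have hsm : ∀ y ∈ W, ContMDiffAt 𝓘(ℝ, E) 𝓘(ℝ, g') ∞ u y := fun y hy =>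
      hΦ'.contMDiffAt_inv hy.2 ((hΦ.contMDiffOn ξ).contMDiffAt (hΦ.isOpen.mem_nhds hy.1))
    -- Here Φ ξ = Φ' u with both frames parallel, so the Leibniz rule leaves 0 = Φ'(du).
    have hd : ∀ y ∈ W, ∀ w, mvfderiv 𝓘(ℝ, E) u y w = 0 := by
      intro y hy w
      have hud := (hsm y hy).mdifferentiableAt (by simp)
      have h1 := hΦ'.cov_apply' cov hy.2 hud w
      have h2 : cov (fun z => Φ z ξ) y = cov (fun z => Φ' z (u z)) y :=
        cov_congr cov (((hΦ.contMDiffOn ξ).contMDiffAt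
          (hΦ.isOpen.mem_nhds hy.1)).mdifferentiableAt (by simp)) (by
          filter_upwards [hΦ'.isOpen.mem_nhds hy.2] with z hz
          rw [hu, hΦ'.apply_inv hz])
      rw [← h2, hpar ξ y hy.1, hpar' _ y hy.2] at h1
      apply (hΦ'.bijective y hy.2).1
      simpa using h1.symm
    set φ := extChartAt 𝓘(ℝ, E) x with hφ
    have hfd : ∀ y ∈ coordDomain (E := E) x W, fderiv ℝ (fun y => u (φ.symm y)) y = 0 := by
      intro y hy
      have hm := symm_mem_of_mem_coordDomain hy
      ext w
      have := mvfderiv_eq_fderiv hm.2 ((hsm _ hm.1).mdifferentiableAt (by simp))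
        (tangentCoordSymm x (φ.symm y) w)
      rw [hd _ hm.1, tangentCoord_symm hm.2, ← hφ, φ.right_inv hy.1] at this
      simpa using this.symm
    have hxm : φ x ∈ coordDomain (E := E) x W := mem_coordDomain hx (mem_chart_source E x)
    obtain ⟨ε, hε, hball⟩ := Metric.isOpen_iff.mp (isOpen_coordDomain (x₀ := x) hWo) _ hxm
    have hconst : ∀ y ∈ Metric.ball (φ x) ε, u (φ.symm y) = u (φ.symm (φ x)) := by
      intro y hy
      refine Metric.isOpen_ball.is_const_of_fderiv_eq_zero (𝕜 := ℝ)
        (convex_ball (φ x) ε).isPreconnected (f := fun y => u (φ.symm y))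
        ?_ (fun z hz => hfd z (hball hz)) hy (Metric.mem_ball_self hε)
      exact ((contDiffOn_comp_symm fun z hz => hsm z hz.1).mono hball).differentiableOn (by simp)
    have hc : ContinuousAt φ x := continuousAt_extChartAt x
    filter_upwards [hc (Metric.ball_mem_nhds _ hε), extChartAt_source_mem_nhds (I := 𝓘(ℝ, E)) x]
      with y hy hy'
    have := hconst _ hy
    rwa [φ.left_inv hy', φ.left_inv (mem_extChartAt_source x)] at this
  -- Finitely many basis vectors give one neighbourhood that works for all ξ.
  have hall : ∀ᶠ y in 𝓝 x, ∀ i, frameInv Φ' y (Φ y (finBasis ℝ g i)) =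
      frameInv Φ' x (Φ x (finBasis ℝ g i)) := eventually_all.mpr fun i => key _
  filter_upwards [hall] with y hy
  exact (finBasis ℝ g).ext hy

end ParallelFrames

/-! ### Monodromy: the covering space of parallel frames. -/

section GlobalFrame

open Filter Topology Module

variable {E : Type*} [NormedAddCommGroup E] [NormedSpace ℝ E] [FiniteDimensional ℝ E]
  {M : Type*} [TopologicalSpace M] [ChartedSpace E M] [IsManifold 𝓘(ℝ, E) ∞ M]
  {F : Type*} [NormedAddCommGroup F] [NormedSpace ℝ F] [FiniteDimensional ℝ F]
  {A : M → Type*} [TopologicalSpace (TotalSpace F A)]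
  [∀ x, AddCommGroup (A x)] [∀ x, Module ℝ (A x)] [∀ x, TopologicalSpace (A x)]
  [∀ x, IsTopologicalAddGroup (A x)] [∀ x, ContinuousSMul ℝ (A x)]
  [FiberBundle F A] [VectorBundle ℝ F A] [ContMDiffVectorBundle ∞ F A 𝓘(ℝ, E)]

/-- The endomorphisms of a vector space, with the discrete topology. -/
def DiscreteEnd (F : Type*) [AddCommGroup F] [Module ℝ F] : Type _ := F →ₗ[ℝ] F

instance : TopologicalSpace (DiscreteEnd F) := ⊥

instance : DiscreteTopology (DiscreteEnd F) := ⟨rfl⟩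

variable {cov : CovariantDerivative 𝓘(ℝ, E) F A} {U : M → Set M}
  {Φ : M → ∀ x : M, F →ₗ[ℝ] A x}

/-- The bundle of parallel frames, with its topology as a covering space, defined by local
parallel frames as trivializations. -/
def parallelFrameCore (hU : ∀ x, x ∈ U x) (hΦ : ∀ x, IsFrame E F (Φ x) (U x))
    (hpar : ∀ x, IsParallelFrame cov (Φ x) (U x)) : FiberBundleCore M M (DiscreteEnd F) where
  baseSet := U
  isOpen_baseSet i := (hΦ i).isOpen
  indexAt x := x
  mem_baseSet_at := hU
  -- In the i-th trivialization, T stands for the map Φ i x ∘ T into the fibre. Singular T are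
  -- allowed too; invertibility is recovered for the section constructed from this covering.
  coordChange i j x T := (frameInv (Φ j) x ∘ₗ Φ i x) ∘ₗ T
  coordChange_self i x hx T := by
    refine LinearMap.ext fun ξ => ?_
    exact (hΦ i).inv_apply hx _
  continuousOn_coordChange i j := by
    rintro ⟨x, T⟩ ⟨hx, -⟩
    refine ContinuousAt.continuousWithinAt ?_
    have hev : ∀ᶠ p : M × DiscreteEnd F in 𝓝 (x, T),
        p.2 = T ∧ frameInv (Φ j) p.1 ∘ₗ Φ i p.1 = frameInv (Φ j) x ∘ₗ Φ i x :=
      (continuous_snd.continuousAt.eventually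
        ((isOpen_discrete {T}).mem_nhds (mem_singleton T))).and
        (continuous_fst.continuousAt.eventually
          (eventually_transition_eq (hΦ i) (hpar i) (hΦ j) (hpar j) hx))
    refine (continuousAt_const (Y := DiscreteEnd F)
      (y := (frameInv (Φ j) x ∘ₗ Φ i x) ∘ₗ T)).congr ?_
    filter_upwards [hev] with p hp
    rw [hp.1, hp.2]
  coordChange_comp i j k x hx T := by
    refine LinearMap.ext fun ξ => ?_
    change frameInv (Φ k) x (Φ j x (frameInv (Φ j) x (Φ i x ((id T : F →ₗ[ℝ] F) ξ)))) = _
    rw [(hΦ j).apply_inv hx.1.2]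
    rfl

/-- On a simply connected manifold, local parallel frames give a global one. -/
theorem exists_global_parallelFrame [SimplyConnectedSpace M]
    (h : ∀ x₀ : M, ∃ (U : Set M) (Φ : ∀ x : M, F →ₗ[ℝ] A x), x₀ ∈ U ∧ IsFrame E F Φ U ∧
      IsParallelFrame cov Φ U) :
    ∃ Φ : ∀ x : M, F →ₗ[ℝ] A x, IsFrame E F Φ univ ∧ IsParallelFrame cov Φ univ := by
  choose U Φ hU hΦ hpar using h
  set Z := parallelFrameCore hU hΦ hpar with hZ
  have : LocallyPathConnectedSpace M := ChartedSpace.locallyPathConnectedSpace E M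
  have hcov : IsCoveringMap Z.proj := FiberBundle.isCoveringMap
  obtain ⟨a₀⟩ : Nonempty M := inferInstance
  -- The identity of M lifts through the covering, with value the identity endomorphism over a₀.
  obtain ⟨s, ⟨hs0, hs⟩, -⟩ := hcov.existsUnique_continuousMap_lifts (ContinuousMap.id M) a₀
    (⟨a₀, (LinearMap.id : F →ₗ[ℝ] F)⟩ : Z.TotalSpace) rfl
  have hproj : ∀ x, (s x).1 = x := fun x => congrFun hs x
  set T : M → (F →ₗ[ℝ] F) := fun x => (s x).2 with hT
  set Ψ : ∀ x : M, F →ₗ[ℝ] A x := fun x => Φ x x ∘ₗ T x with hΨ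
  -- The trivialized section is continuous into a discrete space, hence locally constant: near x₀, Ψ
  -- is a fixed endomorphism followed by the parallel frame at x₀.
  have hloc : ∀ x₀, ∀ᶠ x in 𝓝 x₀, Ψ x = Φ x₀ x ∘ₗ T x₀ := by
    intro x₀
    have hsrc : s x₀ ∈ (Z.localTriv x₀).source := by
      rw [Z.mem_localTriv_source, hproj]
      exact hU x₀
    have hc : ContinuousAt (fun x => (Z.localTriv x₀ (s x)).2) x₀ :=
      continuous_snd.continuousAt.comp
        (((Z.localTriv x₀).continuousAt hsrc).comp (f := s) s.continuous.continuousAt)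
    have hval : ∀ x, (Z.localTriv x₀ (s x)).2 = (frameInv (Φ x₀) x ∘ₗ Φ x x) ∘ₗ T x := by
      intro x
      have : (Z.localTriv x₀ (s x)).2 =
        (frameInv (Φ x₀) (s x).1 ∘ₗ Φ (s x).1 (s x).1) ∘ₗ T x := rfl
      rw [this, hproj]
    have hev := hc.eventually ((isOpen_discrete {(Z.localTriv x₀ (s x₀)).2}).mem_nhds rfl)
    filter_upwards [hev, (hΦ x₀).isOpen.mem_nhds (hU x₀)] with x hx hxU
    have hx : (Z.localTriv x₀ (s x)).2 = (Z.localTriv x₀ (s x₀)).2 := hx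
    rw [hval, hval] at hx
    ext ξ
    have h1 := congrArg (Φ x₀ x) (LinearMap.congr_fun hx ξ)
    change Φ x₀ x (frameInv (Φ x₀) x (Φ x x (T x ξ))) =
      Φ x₀ x (frameInv (Φ x₀) x₀ (Φ x₀ x₀ (T x₀ ξ))) at h1
    rwa [(hΦ x₀).apply_inv hxU, (hΦ x₀).inv_apply (hU x₀)] at h1
  have hbijT : ∀ x₀ x, x ∈ U x₀ → (Function.Bijective (Φ x₀ x ∘ₗ T x₀) ↔
      Function.Bijective (T x₀)) := fun x₀ x hx => by
    rw [LinearMap.coe_comp, ((hΦ x₀).bijective x hx).of_comp_iff']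
  -- Invertibility propagates over the connected M from a₀, where T is the identity.
  have hlc : IsLocallyConstant fun x => Function.Bijective (T x) := by
    rw [IsLocallyConstant.iff_eventually_eq]
    intro x₀
    filter_upwards [hloc x₀, (hΦ x₀).isOpen.mem_nhds (hU x₀)] with x hx hxU
    rw [← hbijT x₀ x hxU, ← hx, ← hbijT x x (hU x)]
  have hbij : ∀ x, Function.Bijective (T x) := by
    intro x
    have h1 : Function.Bijective (T x) = Function.Bijective (T a₀) :=
      hlc.apply_eq_of_isPreconnected isPreconnected_univ (mem_univ x) (mem_univ a₀)
    have h2 : T a₀ = LinearMap.id := by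
      change (show F →ₗ[ℝ] F from (s a₀).2) = _
      rw [hs0]
    rw [h1, h2]
    exact Function.bijective_id
  have hsm : ∀ ξ x, ContMDiffAt 𝓘(ℝ, E) (𝓘(ℝ, E).prod 𝓘(ℝ, F)) ∞
      (fun y => TotalSpace.mk' F y (Φ x y (T x ξ))) x := fun ξ x =>
    ((hΦ x).contMDiffOn _).contMDiffAt ((hΦ x).isOpen.mem_nhds (hU x))
  refine ⟨Ψ, ⟨isOpen_univ, fun x _ => (hbijT x x (hU x)).mpr (hbij x), fun ξ x _ => ?_⟩,
    fun ξ x _ => ?_⟩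
  · refine ((hsm ξ x).congr_of_eventuallyEq ?_).contMDiffWithinAt
    filter_upwards [hloc x] with y hy
    rw [hy]
    rfl
  · rw [← hpar x (T x ξ) x (hU x)]
    refine (cov_congr cov ((hsm ξ x).mdifferentiableAt (by simp)) ?_).symm
    filter_upwards [hloc x] with y hy
    rw [hy]
    rfl

end GlobalFrame

/-! ### The Lie bracket of anchored vector fields in coordinates. -/

section LieBracket

open Filter Topology Module

variable {E : Type*} [NormedAddCommGroup E] [NormedSpace ℝ E] [FiniteDimensional ℝ E]
  {M : Type*} [TopologicalSpace M] [ChartedSpace E M] [IsManifold 𝓘(ℝ, E) ∞ M]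
  {F : Type*} [NormedAddCommGroup F] [NormedSpace ℝ F] [FiniteDimensional ℝ F]
  {A : M → Type*} [TopologicalSpace (TotalSpace F A)]
  [∀ x, AddCommGroup (A x)] [∀ x, Module ℝ (A x)] [∀ x, TopologicalSpace (A x)]
  [∀ x, IsTopologicalAddGroup (A x)] [∀ x, ContinuousSMul ℝ (A x)]
  [FiberBundle F A] [VectorBundle ℝ F A] [ContMDiffVectorBundle ∞ F A 𝓘(ℝ, E)]
  {g : Type*} [NormedAddCommGroup g] [NormedSpace ℝ g] [FiniteDimensional ℝ g]

variable {Φ : ∀ x : M, g →ₗ[ℝ] A x} {U : Set M} {x : M}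

/-- The Lie bracket of vector fields in the chart at a point. -/
theorem tangentCoord_mlieBracket (V W : ∀ x : M, TangentSpace 𝓘(ℝ, E) x) (x : M) :
    tangentCoord x x (VectorField.mlieBracket 𝓘(ℝ, E) V W x) =
      VectorField.lieBracket ℝ
        (fun y => tangentCoord x ((extChartAt 𝓘(ℝ, E) x).symm y)
          (V ((extChartAt 𝓘(ℝ, E) x).symm y)))
        (fun y => tangentCoord x ((extChartAt 𝓘(ℝ, E) x).symm y)
          (W ((extChartAt 𝓘(ℝ, E) x).symm y))) (extChartAt 𝓘(ℝ, E) x x) := by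
  set φ := extChartAt 𝓘(ℝ, E) x with hφ
  have hbase : ∀ z ∈ (chartAt E x).source,
      z ∈ (trivializationAt E (TangentSpace 𝓘(ℝ, E) (M := M)) x).baseSet := fun z hz => by
    simpa using hz
  have hinv : ∀ z ∈ (chartAt E x).source, ∀ L : E →L[ℝ] TangentSpace 𝓘(ℝ, E) z,
      L = tangentCoordSymm x z → L.inverse = tangentCoord x z := by
    rintro z hz L rfl
    rw [tangentCoordSymm, ← Trivialization.symm_continuousLinearEquivAt_eq' _ (hbase z hz),
      ContinuousLinearMap.inverse_equiv, ContinuousLinearEquiv.symm_symm,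
      Trivialization.coe_continuousLinearEquivAt_eq']
    rfl
  have hinv' : ∀ L : TangentSpace 𝓘(ℝ, E) x →L[ℝ] E, L = tangentCoord x x →
      ∀ w, tangentCoord x x (L.inverse w) = w := by
    rintro L rfl w
    have hx := mem_chart_source E x
    rw [tangentCoord, ← Trivialization.coe_continuousLinearEquivAt_eq' _ (hbase x hx),
      ContinuousLinearMap.inverse_equiv]
    exact ContinuousLinearEquiv.apply_symm_apply _ w
  -- The bracket on M is computed from fields pulled back along the inverse chart; near the base
  -- point these are the coordinate expressions of the fields.
  have hpull : ∀ S : ∀ x : M, TangentSpace 𝓘(ℝ, E) x,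
      (VectorField.mpullbackWithin 𝓘(ℝ, E) 𝓘(ℝ, E) φ.symm S (range 𝓘(ℝ, E)) : E → E) =ᶠ[𝓝 (φ x)]
        fun y => tangentCoord x (φ.symm y) (S (φ.symm y)) := by
    intro S
    filter_upwards [extChartAt_target_mem_nhds (I := 𝓘(ℝ, E)) x] with y hy
    have hs : φ.symm y ∈ (chartAt E x).source := by
      simpa only [hφ, extChartAt_source] using φ.map_target hy
    have h1 := TangentBundle.symmL_trivializationAt (I := 𝓘(ℝ, E)) hs
    rw [φ.right_inv hy] at h1
    rw [← hinv _ hs _ h1.symm]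
    rfl
  have hkey : ∀ V₁ W₁ V₂ W₂ : E → E, V₁ =ᶠ[𝓝 (φ x)] V₂ → W₁ =ᶠ[𝓝 (φ x)] W₂ →
      VectorField.lieBracketWithin ℝ V₁ W₁ (φ.symm ⁻¹' univ ∩ range 𝓘(ℝ, E)) (φ x) =
        VectorField.lieBracket ℝ V₂ W₂ (φ x) := by
    intro V₁ W₁ V₂ W₂ hV hW
    rw [preimage_univ, univ_inter, modelWithCornersSelf_coe, range_id,
      VectorField.lieBracketWithin_univ]
    exact hV.lieBracket_vectorField_eq hW
  exact (hinv' _ (TangentBundle.continuousLinearMapAt_trivializationAt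
    (mem_chart_source E x)).symm _).trans (hkey _ _ _ _ (hpull V) (hpull W))

/-- In a parallel frame, the anchor defect is the Lie bracket of the anchors of constant sections. -/
theorem tangentCoord_mlieBracket_anchor (ρ : Anchor 𝓘(ℝ, E) F A)
    {cov : CovariantDerivative 𝓘(ℝ, E) F A} (hΦ : IsFrame E F Φ U)
    (hpar : IsParallelFrame cov Φ U) (hx : x ∈ U) (ξ η : g) :
    tangentCoord x x (VectorField.mlieBracket 𝓘(ℝ, E) (fun y => ρ.toFun y (Φ y ξ))
      (fun y => ρ.toFun y (Φ y η)) x) =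
    anchorDefect (coordAnchor ρ Φ x) (coordForm cov Φ x) (extChartAt 𝓘(ℝ, E) x x) ξ η := by
  have hy := mem_coordDomain (E := E) hx (mem_chart_source E x)
  have hr := ((contDiffOn_coordAnchor (x₀ := x) ρ hΦ).contDiffAt
    ((isOpen_coordDomain (E := E) hΦ.isOpen).mem_nhds hy)).differentiableAt (by simp)
  rw [tangentCoord_mlieBracket]
  -- With θ = 0, the two remaining terms of `anchorDefect` are the bracket of the coordinate fields
  -- r(·)ξ and r(·)η.
  change fderiv ℝ (fun y => coordAnchor ρ Φ x y η) _ (coordAnchor ρ Φ x _ ξ) -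
    fderiv ℝ (fun y => coordAnchor ρ Φ x y ξ) _ (coordAnchor ρ Φ x _ η) = _
  rw [anchorDefect, coordForm_eq_zero hΦ hpar hy, fderiv_clm_apply hr (by fun_prop),
    fderiv_clm_apply hr (by fun_prop)]
  simp

end LieBracket

/-! ### Parallel frames versus abelian action algebroids. -/

section ActionAlgebroid

open Filter Topology Module

variable {E : Type*} [NormedAddCommGroup E] [NormedSpace ℝ E] [FiniteDimensional ℝ E]
  {M : Type*} [TopologicalSpace M] [ChartedSpace E M] [IsManifold 𝓘(ℝ, E) ∞ M]
  {F : Type*} [NormedAddCommGroup F] [NormedSpace ℝ F] [FiniteDimensional ℝ F]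
  {A : M → Type*} [TopologicalSpace (TotalSpace F A)]
  [∀ x, AddCommGroup (A x)] [∀ x, Module ℝ (A x)] [∀ x, TopologicalSpace (A x)]
  [∀ x, IsTopologicalAddGroup (A x)] [∀ x, ContinuousSMul ℝ (A x)]
  [FiberBundle F A] [VectorBundle ℝ F A] [ContMDiffVectorBundle ∞ F A 𝓘(ℝ, E)]
  {g : Type*} [NormedAddCommGroup g] [NormedSpace ℝ g] [FiniteDimensional ℝ g]

variable {U : TopologicalSpace.Opens M}

/-- The real vector space of dimension `n`, as an abelian Lie algebra. -/
def AbelianModel (n : ℕ) : Type := Fin n → ℝ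

namespace AbelianModel

variable (n : ℕ)

instance : NormedAddCommGroup (AbelianModel n) := inferInstanceAs (NormedAddCommGroup (Fin n → ℝ))

instance : NormedSpace ℝ (AbelianModel n) := inferInstanceAs (NormedSpace ℝ (Fin n → ℝ))

instance : FiniteDimensional ℝ (AbelianModel n) :=
  inferInstanceAs (FiniteDimensional ℝ (Fin n → ℝ))

instance : NormedLieRing (AbelianModel n) where
  bracket _ _ := 0
  add_lie _ _ _ := (add_zero 0).symm
  lie_add _ _ _ := (add_zero 0).symm
  lie_self _ := rfl
  leibniz_lie _ _ _ := (add_zero 0).symm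

instance : NormedLieAlgebra (AbelianModel n) where
  lie_smul t _ _ := (smul_zero t).symm

instance : IsLieAbelian (AbelianModel n) := ⟨fun _ _ => rfl⟩

theorem finrank_eq : finrank ℝ (AbelianModel n) = n := finrank_fin_fun ℝ

end AbelianModel

theorem IsFrame.comp_equiv {g' : Type*} [NormedAddCommGroup g'] [NormedSpace ℝ g']
    {Φ : ∀ x : M, g →ₗ[ℝ] A x} {V : Set M} (hΦ : IsFrame E F Φ V) (e : g' ≃ₗ[ℝ] g) :
    IsFrame E F (fun x => Φ x ∘ₗ e.toLinearMap) V :=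
  ⟨hΦ.isOpen, fun x hx => (hΦ.bijective x hx).comp e.bijective, fun ξ => hΦ.contMDiffOn (e ξ)⟩

/-- A frame is smooth as a map on the total space of the trivial bundle. -/
theorem IsFrame.contMDiffOn_prod {Φ : ∀ x : M, g →ₗ[ℝ] A x} {V : Set M}
    (hΦ : IsFrame E F Φ V) :
    ContMDiffOn (𝓘(ℝ, E).prod 𝓘(ℝ, g)) (𝓘(ℝ, E).prod 𝓘(ℝ, F)) ∞
      (fun p : M × g => TotalSpace.mk' F p.1 (Φ p.1 p.2)) (V ×ˢ univ) := by
  rintro ⟨x, ξ⟩ ⟨hx, -⟩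
  refine ContMDiffAt.contMDiffWithinAt ?_
  rw [Bundle.contMDiffAt_totalSpace]
  refine ⟨contMDiffAt_fst, ?_⟩
  set e := trivializationAt F A x with he
  have hb : x ∈ e.baseSet := mem_baseSet_trivializationAt F A x
  have h1 : ∀ i, ContMDiffAt 𝓘(ℝ, E) 𝓘(ℝ, F) ∞
      (fun y => (e ⟨y, Φ y (finBasis ℝ g i)⟩).2) x := fun i =>
    (e.contMDiffAt_section_iff hb).mp
      ((hΦ.contMDiffOn (finBasis ℝ g i)).contMDiffAt (hΦ.isOpen.mem_nhds hx))
  have h2 : ∀ i, ContMDiffAt (𝓘(ℝ, E).prod 𝓘(ℝ, g)) 𝓘(ℝ, F) ∞ (fun p : M × g =>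
      (finBasis ℝ g).repr p.2 i • (e ⟨p.1, Φ p.1 (finBasis ℝ g i)⟩).2) (x, ξ) := fun i =>
    ((LinearMap.toContinuousLinearMap
      ((finBasis ℝ g).coord i)).contMDiff.contMDiffAt.comp (x, ξ) contMDiffAt_snd).smul
      (ContMDiffAt.comp (x, ξ) (f := Prod.fst) (h1 i) contMDiffAt_fst)
  refine (contMDiffAt_finsetSum (t := Finset.univ) fun i _ => h2 i).congr_of_eventuallyEq ?_
  filter_upwards [continuous_fst.continuousAt.eventually
    (e.open_baseSet.mem_nhds (x := x) hb)] with p hp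
  have h3 : ∀ v : A p.1, (e ⟨p.1, v⟩).2 = e.continuousLinearMapAt ℝ p.1 v := fun v => by
    rw [Trivialization.continuousLinearMapAt_apply, Trivialization.linearMapAt_apply]
    exact (if_pos hp).symm
  simp only [h3]
  rw [frame_apply_eq_sum Φ (fun _ => p.2) p.1, map_sum]
  simp only [map_smul]

theorem IsFrame.contMDiffOn_of_prod {Φ : ∀ x : M, g →ₗ[ℝ] A x} {V : Set M} (hV : IsOpen V)
    (hbij : ∀ x ∈ V, Function.Bijective (Φ x))
    (h : ContMDiffOn (𝓘(ℝ, E).prod 𝓘(ℝ, g)) (𝓘(ℝ, E).prod 𝓘(ℝ, F)) ∞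
      (fun p : M × g => TotalSpace.mk' F p.1 (Φ p.1 p.2)) (V ×ˢ univ)) : IsFrame E F Φ V :=
  ⟨hV, hbij, fun ξ => h.comp (contMDiffOn_id.prodMk (contMDiffOn_const (c := ξ)))
    fun _ hx => ⟨hx, mem_univ _⟩⟩

/-- A parallel frame identifies a pre-Lie algebroid with an abelian action algebroid. -/
theorem isAbelianActionAlgebroidOn_of_parallelFrame [T2Space M] {ρ : Anchor 𝓘(ℝ, E) F A}
    (hρ : ρ.Transitive) {cov : CovariantDerivative 𝓘(ℝ, E) F A}
    [CovariantDerivative.ContMDiffCovariantDerivative cov ∞]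
    (h : (inducedConnection ρ cov).IsPreLieAlgebroid) {Φ : ∀ x : M, g →ₗ[ℝ] A x}
    (hΦ : IsFrame E F Φ U) (hpar : IsParallelFrame cov Φ U) :
    IsAbelianActionAlgebroidOn ρ cov U := by
  -- The Lie algebra must live in `Type`, so g is replaced by the coordinate space of the same
  -- dimension.
  let e : AbelianModel (finrank ℝ g) ≃ₗ[ℝ] g :=
    LinearEquiv.ofFinrankEq _ _ (AbelianModel.finrank_eq _)
  have hΨ := hΦ.comp_equiv e
  have hparΨ : IsParallelFrame cov (fun x => Φ x ∘ₗ e.toLinearMap) U := fun ξ => hpar (e ξ)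
  set Ψ : ∀ x : M, AbelianModel (finrank ℝ g) →ₗ[ℝ] A x := fun x => Φ x ∘ₗ e.toLinearMap
  have hcov : ∀ u : M → AbelianModel (finrank ℝ g),
      ContMDiffOn 𝓘(ℝ, E) 𝓘(ℝ, AbelianModel (finrank ℝ g)) ∞ u U → ∀ x ∈ U,
      ∀ w : TangentSpace 𝓘(ℝ, E) x,
      cov (fun y => Ψ y (u y)) x w = Ψ x (mvfderiv 𝓘(ℝ, E) u x w) := fun u hu x hx w => by
    rw [hΨ.cov_apply' cov hx ((hu.contMDiffAt (U.isOpen.mem_nhds hx)).mdifferentiableAt (by simp)),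
      hparΨ _ x hx]
    exact add_zero _
  refine ⟨AbelianModel (finrank ℝ g), inferInstance, inferInstance, inferInstance, inferInstance,
    ⟨fun x => (ρ.toFun x).toLinearMap ∘ₗ Ψ x, fun ξ => ρ.smooth.comp_contMDiffOn
      (hΨ.contMDiffOn ξ), fun ξ η x hx => ?_⟩, fun x hx => ?_,
    ⟨Ψ, hΨ.contMDiffOn_prod, hΨ.bijective, fun _ _ _ => rfl, fun u v hu hv x hx => ?_⟩, hcov⟩
  -- Homomorphism property: the bracket of the Lie algebra is zero, and the vector fields commute
  -- because their bracket is the vanishing anchor defect.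
  · have h1 := tangentCoord_mlieBracket_anchor ρ hΨ hparΨ hx ξ η
    rw [anchorDefect_coord_eq_zero hρ h hΨ (mem_coordDomain hx (mem_chart_source E x))] at h1
    rw [trivial_lie_zero, map_zero]
    have h2 := congrArg (tangentCoordSymm x x) h1
    rw [tangentCoordSymm_coord (mem_chart_source E x), map_zero] at h2
    exact h2.symm
  · exact (hρ x).comp (hΨ.bijective x hx).2
  -- Since ∇ acts as d on coefficients, both brackets are the image of dv(ρ(u)) - du(ρ(v)).
  · rw [commutatorBracket, rawProd, rawProd, hcov v hv x hx, hcov u hu x hx, ← map_sub,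
      LieAlgebraAction.bracket, trivial_lie_zero, zero_add]
    rfl

/-- The triple bracket vanishes where there is an isomorphism with an abelian action
algebroid. -/
theorem IsAbelianActionAlgebroidOn.tripleBracket_apply [T2Space M] {ρ : Anchor 𝓘(ℝ, E) F A}
    {cov : CovariantDerivative 𝓘(ℝ, E) F A}
    [CovariantDerivative.ContMDiffCovariantDerivative cov ∞]
    (h : IsAbelianActionAlgebroidOn ρ cov U) (X Y Z : Cₛ^∞⟮𝓘(ℝ, E); F, A⟯) {x : M} (hx : x ∈ U) :
    (inducedConnection ρ cov).tripleBracket X Y Z x = 0 := by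
  obtain ⟨g, _, _, _, _, a, -, Φ, hpres⟩ := h
  have hΦ : IsFrame E F Φ.toFun U := .contMDiffOn_of_prod U.isOpen Φ.bijective Φ.smooth
  -- Constant functions have zero derivative, so preservation of the connection makes their images
  -- parallel.
  have hpar : IsParallelFrame cov Φ.toFun U := fun ξ z hz => by
    ext w
    rw [hpres (fun _ => ξ) contMDiffOn_const z hz w, flatConnection, mvfderiv_const]
    exact map_zero _
  have hy := mem_coordDomain (E := E) hx (mem_chart_source E x)
  set y := extChartAt 𝓘(ℝ, E) x x with hy_def
  have hnhds := (isOpen_coordDomain (E := E) (x₀ := x) hΦ.isOpen).mem_nhds hy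
  have hanchor : ∀ ξ, (fun z => a.toFun z ξ) =ᶠ[𝓝 x] fun z => ρ.toFun z (Φ.toFun z ξ) := fun ξ => by
    filter_upwards [U.isOpen.mem_nhds hx] with z hz using (Φ.map_anchor z hz ξ).symm
  -- The fields of an abelian action commute, and near x they are the anchors of the constant
  -- sections.
  have hdef : ∀ ξ η, anchorDefect (coordAnchor ρ Φ.toFun x) (coordForm cov Φ.toFun x) y ξ η = 0 := by
    intro ξ η
    rw [← tangentCoord_mlieBracket_anchor ρ hΦ hpar hx,
      ← (hanchor ξ).mlieBracket_vectorField_eq (hanchor η), ← a.map_lie ξ η x hx,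
      trivial_lie_zero, map_zero, map_zero]
  have hform : coordForm cov Φ.toFun x =ᶠ[𝓝 y] fun _ => 0 := by
    filter_upwards [hnhds] with z hz using coordForm_eq_zero hΦ hpar hz
  have hcurv : ∀ k l, curvatureForm (coordForm cov Φ.toFun x) y k l = 0 := by
    intro k l
    simp [curvatureForm, hform.fderiv_eq, hform.eq_of_nhds]
  have hs : ∀ S : Cₛ^∞⟮𝓘(ℝ, E); F, A⟯, ContDiffAt ℝ ∞ (coordSection (E := E) Φ.toFun x S) y :=
    fun S => (contDiffOn_coordSection hΦ S).contDiffAt hnhds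
  have h0 := coordSection_tripleBracket ρ cov hΦ X Y Z hy
  rw [localTriple_eq (((contDiffOn_coordAnchor ρ hΦ).contDiffAt hnhds).differentiableAt (by simp))
    (((contDiffOn_coordForm cov hΦ).contDiffAt hnhds).differentiableAt (by simp))
    ((hs X).differentiableAt (by simp)) ((hs Y).differentiableAt (by simp))
    ((hs Z).of_le ENat.LEInfty.out), hdef, hcurv, hy_def,
    coordSection_apply _ (mem_chart_source E x)] at h0
  -- With zero defect and zero curvature, the coefficients of the triple bracket in the frame vanish
  -- at x, hence so does the bracket.
  rw [← hΦ.apply_inv hx ((inducedConnection ρ cov).tripleBracket X Y Z x), h0]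
  simp

end ActionAlgebroid

end PreLieAlgebroid

end

theorem mainTheorem2
    {E : Type*} [NormedAddCommGroup E] [NormedSpace ℝ E] [FiniteDimensional ℝ E]
    {M : Type*} [TopologicalSpace M] [ChartedSpace E M] [IsManifold 𝓘(ℝ, E) ∞ M] [T2Space M]
    {F : Type*} [NormedAddCommGroup F] [NormedSpace ℝ F] [FiniteDimensional ℝ F]
    {A : M → Type*} [TopologicalSpace (TotalSpace F A)]
    [∀ x, AddCommGroup (A x)] [∀ x, Module ℝ (A x)] [∀ x, TopologicalSpace (A x)]
    [∀ x, IsTopologicalAddGroup (A x)] [∀ x, ContinuousSMul ℝ (A x)]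
    [FiberBundle F A] [VectorBundle ℝ F A] [ContMDiffVectorBundle ∞ F A 𝓘(ℝ, E)]
    (ρ : PreLieAlgebroid.Anchor 𝓘(ℝ, E) F A) (hρ : ρ.Transitive)
    (cov : CovariantDerivative 𝓘(ℝ, E) F A) [CovariantDerivative.ContMDiffCovariantDerivative cov ∞] :
    ((PreLieAlgebroid.inducedConnection ρ cov).IsPreLieAlgebroid ↔
      ∀ x : M, ∃ U : TopologicalSpace.Opens M, x ∈ U ∧
        PreLieAlgebroid.IsAbelianActionAlgebroidOn ρ cov U) ∧
    (SimplyConnectedSpace M →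
      ((PreLieAlgebroid.inducedConnection ρ cov).IsPreLieAlgebroid ↔
        PreLieAlgebroid.IsAbelianActionAlgebroidOn ρ cov ⊤)) := by
  refine ⟨⟨fun h x => ?_, fun h X Y Z => ?_⟩, fun hM => ⟨fun h => ?_, fun h X Y Z => ?_⟩⟩
  · obtain ⟨U, Φ, hxU, hΦ, hpar⟩ := PreLieAlgebroid.exists_parallelFrame hρ h x
    exact ⟨⟨U, hΦ.isOpen⟩, hxU,
      PreLieAlgebroid.isAbelianActionAlgebroidOn_of_parallelFrame hρ h hΦ hpar⟩
  · ext x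
    obtain ⟨U, hxU, hU⟩ := h x
    exact hU.tripleBracket_apply X Y Z hxU
  · obtain ⟨Φ, hΦ, hpar⟩ := PreLieAlgebroid.exists_global_parallelFrame
      (PreLieAlgebroid.exists_parallelFrame hρ h)
    exact PreLieAlgebroid.isAbelianActionAlgebroidOn_of_parallelFrame hρ h hΦ hpar
  · ext x
    exact h.tripleBracket_apply X Y Z (TopologicalSpace.Opens.mem_top x)
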